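/- Let $k$ be a field and let $s\ge 0$ be an integer. For a commutative $k$-algebra $R$ and $n\in\{1,2,3,\dots\}\cup\{\infty\}$, identify a power series $f=\sum_{1\le |w|\le n} f_w z_w$ (without constant term, in $s$ non-commuting variables, coefficients in $R$, truncated at degree $n$) with the family of its coefficients $f_w$, indexed by the non-empty words $w$ of length $|w|\le n$ over the alphabet $\{1,\dots,s\}$. For a word $w=i_1\cdots i_m$ and a block $V=\{v_1<\dots<v_r\}\subseteq\{1,\dots,m\}$ put $w|V=i_{v_1}\cdots i_{v_r}$, and for a partition $\pi$ of $\{1,\dots,m\}$ put $f_{w,\pi}=\prod_{V\in\pi}f_{w|V}$. The boxed convolution is $$(f\boxtimes g)_w=\sum_{\pi\in NC(|w|)} f_{w,\pi}\,g_{w,K(\pi)},$$ where $NC(m)$ is the set of non-crossing partitions of $\{1,\dots,m\}$ and $K(\pi)$ is the Kreweras complement of $\pi$, i.e. the greatest non-crossing partition $\kappa$ of $\{\bar 1,\dots,\bar m\}$ such that $\pi\cup\kappa$ is a non-crossing partition of $1<\bar 1<2<\bar 2<\dots<m<\bar m$. Let $(\mathfrak G^s)_n(R)$ be the set of those $f$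 with $f_i\in R^\times$ for all letters $i$, and $(\mathfrak G^s_+)_n(R)$ the set of those $f$ with $f_i=1$ for all letters $i$, both with the operation $\boxtimes$; put $\mathfrak G^s=(\mathfrak G^s)_\infty$ and $\mathfrak G^s_+=(\mathfrak G^s_+)_\infty$. These are functors of $R$, and for $m\le n$ truncation of series gives natural maps $(\mathfrak G^s)_n\to(\mathfrak G^s)_m$ and $(\mathfrak G^s_+)_n\to(\mathfrak G^s_+)_m$ that respect $\boxtimes$. An affine group scheme $G$ over $k$ is a group-valued functor on commutative $k$-algebras represented by a commutative Hopf algebra $k[G]$ (the group operation being the convolution product on $\mathrm{Hom}_{k\text{-alg}}(k[G],R)$); it is an algebraic group if $k[G]$ is a finitely generated $k$-algebra. $G$ is called unipotent if every non-zero linear representation of $G$, i.e. every non-zero right $k[G]$-comodule $\rho:V\to V\otimes_k k[G]$, contains a vector $v\neq0$ with $\rho(v)=v\otimes 1$; it is called trigonalisable if every such $V$ contains a vector $v\ne0$ with $\rho(v)=v\otimes a$ for some $a\in k[G]$. $G$ is called pro-unipotent if it is the limit of a directed inverse system of unipotent algebraic groups. **Proposition.** 1. For every $n\ge1$, $(\mathfrak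 G^s_+)_n$ is a unipotent algebraic group over $k$. The functor $\mathfrak G^s_+$ is the inverse limit of the $(\mathfrak G^s_+)_n$, $n\ge 1$, along the truncations, and it is a pro-unipotent affine group scheme; it is also unipotent in the sense above. 2. For every $n\ge1$, $(\mathfrak G^s)_n$ is a trigonalisable algebraic group over $k$. The functor $\mathfrak G^s$ is the inverse limit of the $(\mathfrak G^s)_n$, $n\ge 1$, along the truncations, and it is a trigonalisable affine group scheme. -/

import Mathlib

open CategoryTheory CategoryTheory.Limits
open scoped TensorProduct

universe u v

namespace FreeBox

/-! ### Non-crossing partitions and the Kreweras complement -/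

section NonCrossing

/-- A family `P` of blocks in a linearly ordered set is non-crossing if there are no
`p₁ < q₁ < p₂ < q₂` with `p₁, p₂` in one block and `q₁, q₂` in a different block. -/
def IsNonCrossing {α : Type*} [LinearOrder α] (P : Finset (Finset α)) : Prop :=
  ∀ V ∈ P, ∀ W ∈ P, ∀ p₁ ∈ V, ∀ q₁ ∈ W, ∀ p₂ ∈ V, ∀ q₂ ∈ W,
    p₁ < q₁ → q₁ < p₂ → p₂ < q₂ → V = W

instance {α : Type*} [LinearOrder α] (P : Finset (Finset α)) : Decidable (IsNonCrossing P) := by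
  unfold IsNonCrossing; infer_instance

/-- The blocks of `π ∪ κ` on `1 < 1̄ < 2 < 2̄ < ⋯ < n < n̄`: the blocks of `π` live on the letters
`i = (i, false)`, those of `κ` on the barred letters `ī = (i, true)`. -/
def interleave {n : ℕ} (π κ : Finpartition (Finset.univ : Finset (Fin n))) :
    Finset (Finset (Fin n ×ₗ Bool)) :=
  π.parts.image (fun V => V.image fun i => toLex (i, false)) ∪
    κ.parts.image (fun V => V.image fun i => toLex (i, true))

/-- The relation `ī ∼ j̄`: no block of `π` meets both the set of letters lying between `ī` and `j̄`
and its complement (a letter `x` lies outside this set iff `i < x ↔ j < x`). -/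
def krewerasSetoid {n : ℕ} (π : Finpartition (Finset.univ : Finset (Fin n))) :
    Setoid (Fin n) where
  r i j := ∀ V ∈ π.parts, ∀ x ∈ V, ∀ y ∈ V, ((i < x ↔ j < x) ↔ (i < y ↔ j < y))
  iseqv :=
    { refl := fun _ _ _ _ _ _ _ => by simp
      symm := fun h V hV x hx y hy => by have := h V hV x hx y hy; tauto
      trans := fun h h' V hV x hx y hy => by
        have h1 := h V hV x hx y hy
        have h2 := h' V hV x hx y hy
        tauto }

instance {n : ℕ} (π : Finpartition (Finset.univ : Finset (Fin n))) :
    DecidableRel (krewerasSetoid π).r := fun i j =>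
  inferInstanceAs (Decidable
    (∀ V ∈ π.parts, ∀ x ∈ V, ∀ y ∈ V, ((i < x ↔ j < x) ↔ (i < y ↔ j < y))))

/-- The Kreweras complement `K(π)`; see `kreweras_isGreatest` for its defining property. -/
def kreweras {n : ℕ} (π : Finpartition (Finset.univ : Finset (Fin n))) :
    Finpartition (Finset.univ : Finset (Fin n)) :=
  Finpartition.ofSetoid (krewerasSetoid π)

theorem kreweras_rel {n : ℕ} (π : Finpartition (Finset.univ : Finset (Fin n)))
    {W : Finset (Fin n)} (hW : W ∈ (kreweras π).parts) {i j : Fin n} (hi : i ∈ W) :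
    j ∈ W ↔ (krewerasSetoid π).r i j := by
  have h := Finpartition.mem_part_ofSetoid_iff_rel (s := krewerasSetoid π) (a := i) (b := j)
  rw [show (Finpartition.ofSetoid (krewerasSetoid π)).part i = W from
    (kreweras π).part_eq_of_mem hW hi] at h
  exact h

/-- `K(π)` is the greatest (with respect to refinement) non-crossing partition `κ` of the barred
letters such that `π ∪ κ` is non-crossing. -/
theorem kreweras_isGreatest {n : ℕ} (π : Finpartition (Finset.univ : Finset (Fin n)))
    (hπ : IsNonCrossing π.parts) :
    IsGreatest {κ | IsNonCrossing κ.parts ∧ IsNonCrossing (interleave π κ)} (kreweras π) := by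
  have hK : IsNonCrossing (kreweras π).parts := by
    intro V hV W hW p₁ hp₁ q₁ hq₁ p₂ hp₂ q₂ hq₂ h1 h2 h3
    have a := (kreweras_rel π hV hp₁).1 hp₂
    have b := (kreweras_rel π hW hq₁).1 hq₂
    have hp₂W : p₂ ∈ W := by
      rw [kreweras_rel π hW hq₁]
      intro U hU x hx y hy
      have a' := a U hU x hx y hy
      have b' := b U hU x hx y hy
      grind
    exact (kreweras π).eq_of_mem_parts hV hW hp₂ hp₂W
  have htf : ¬ (true < false) := by decide
  refine ⟨⟨hK, ?_⟩, ?_⟩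
  · intro V hV W hW p₁ hp₁ q₁ hq₁ p₂ hp₂ q₂ hq₂ h1 h2 h3
    simp only [interleave, Finset.mem_union, Finset.mem_image] at hV hW
    rcases hV with ⟨V, hV, rfl⟩ | ⟨V, hV, rfl⟩ <;> rcases hW with ⟨W, hW, rfl⟩ | ⟨W, hW, rfl⟩ <;>
      simp only [Finset.mem_image] at hp₁ hq₁ hp₂ hq₂ <;>
      obtain ⟨p₁, hp₁, rfl⟩ := hp₁ <;> obtain ⟨q₁, hq₁, rfl⟩ := hq₁ <;>
      obtain ⟨p₂, hp₂, rfl⟩ := hp₂ <;> obtain ⟨q₂, hq₂, rfl⟩ := hq₂ <;>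
      simp [Prod.Lex.toLex_lt_toLex] at h1 h2 h3
    · rw [hπ V hV W hW p₁ hp₁ q₁ hq₁ p₂ hp₂ q₂ hq₂ h1 h2 h3]
    · have := (kreweras_rel π hW hq₁).1 hq₂ V hV p₁ hp₁ p₂ hp₂
      exfalso
      grind
    · have := (kreweras_rel π hV hp₁).1 hp₂ W hW q₁ hq₁ q₂ hq₂
      exfalso
      grind
    · rw [hK V hV W hW p₁ hp₁ q₁ hq₁ p₂ hp₂ q₂ hq₂ h1 h2 h3]
  · rintro κ ⟨-, hκ⟩ V hV
    obtain ⟨i, hi⟩ := κ.nonempty_of_mem_parts hV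
    refine ⟨(kreweras π).part i, (kreweras π).part_mem.2 (Finset.mem_univ i), fun j hj => ?_⟩
    rw [kreweras_rel π ((kreweras π).part_mem.2 (Finset.mem_univ i))
      ((kreweras π).mem_part (Finset.mem_univ i))]
    have key : ∀ i ∈ V, ∀ j ∈ V, i ≤ j → ∀ U ∈ π.parts, ∀ x ∈ U, ∀ y ∈ U,
        i < x → x ≤ j → ¬ (i < y ∧ y ≤ j) → False := by
      intro i hi j hj hij U hU x hx y hy h1 h2 h3
      have hU' : U.image (fun i => toLex (i, false)) ∈ interleave π κ :=
        Finset.mem_union_left _ (Finset.mem_image_of_mem _ hU)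
      have hV' : V.image (fun i => toLex (i, true)) ∈ interleave π κ :=
        Finset.mem_union_right _ (Finset.mem_image_of_mem _ hV)
      have hne : U.image (fun i => toLex (i, false)) ≠ V.image (fun i => toLex (i, true)) := by
        intro h
        have := h ▸ Finset.mem_image_of_mem (fun i => toLex (i, false)) hx
        simp at this
      have mU : ∀ z ∈ U, toLex (z, false) ∈ U.image (fun i => toLex (i, false)) :=
        fun z hz => Finset.mem_image_of_mem _ hz
      have mV : ∀ z ∈ V, toLex (z, true) ∈ V.image (fun i => toLex (i, true)) :=
        fun z hz => Finset.mem_image_of_mem _ hz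
      rcases le_or_gt y i with hy' | hy'
      · refine hne (hκ _ hU' _ hV' _ (mU y hy) _ (mV i hi) _ (mU x hx) _ (mV j hj) ?_ ?_ ?_) <;>
          simp [Prod.Lex.toLex_lt_toLex] <;> grind
      · refine hne (hκ _ hV' _ hU' _ (mV i hi) _ (mU x hx) _ (mV j hj) _ (mU y hy) ?_ ?_ ?_).symm <;>
          simp [Prod.Lex.toLex_lt_toLex] <;> grind
    intro U hU x hx y hy
    rcases le_total i j with hij | hij
    · have h1 := key i hi j hj hij U hU x hx y hy
      have h2 := key i hi j hj hij U hU y hy x hx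
      grind
    · have h1 := key j hj i hi hij U hU x hx y hy
      have h2 := key j hj i hi hij U hU y hy x hx
      grind

end NonCrossing

/-! ### Words, series and the boxed convolution -/

section Box

variable {s : ℕ} {n : ℕ∞}

/-- The words `w` with `1 ≤ |w| ≤ n` over the alphabet `[s]`; all non-empty words if `n = ⊤`. -/
def Word (s : ℕ) (n : ℕ∞) : Type :=
  {w : List (Fin s) // w ≠ [] ∧ (w.length : ℕ∞) ≤ n}

/-- The length `|w|`. -/
abbrev Word.length (w : Word s n) : ℕ := w.1.length

/-- The restriction `w|V = (i_{v₁} ⋯ i_{vₘ})` of `w = (i₁ ⋯ iₙ)` to `V = {v₁ < ⋯ < vₘ}`. -/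
def Word.restrict (w : Word s n) (V : Finset (Fin w.length)) (hV : V.Nonempty) : Word s n :=
  ⟨V.sort.map w.1.get, by
    constructor
    · intro h
      have := congrArg List.length h
      simp at this
      exact hV.ne_empty this
    · refine le_trans ?_ w.2.2
      have : V.card ≤ w.1.length := by simpa using V.card_le_univ
      simpa using this⟩

/-- Words of length at most `m` are words of length at most `n` if `m ≤ n`. -/
def Word.incl {m n : ℕ∞} (h : m ≤ n) (w : Word s m) : Word s n := ⟨w.1, w.2.1, w.2.2.trans h⟩

variable {R : Type*} [CommRing R]

/-- `X_{w,π}(f) = ∏_{V ∈ π} X_{w|V}(f)`. A series `∑_w f_w z_w` without constant term, truncated at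
degree `n`, is given by its coefficients `f_w`, `1 ≤ |w| ≤ n`. -/
def coeffProd (f : Word s n → R) (w : Word s n)
    (π : Finpartition (Finset.univ : Finset (Fin w.length))) : R :=
  ∏ V : {V // V ∈ π.parts}, f (w.restrict V.1 (π.nonempty_of_mem_parts V.2))

/-- The boxed convolution: `X_w(f ⊠ g) = ∑_{π ∈ NC(|w|)} X_{w,π}(f) X_{w,K(π)}(g)`. -/
def boxConv (f g : Word s n → R) : Word s n → R := fun w =>
  ∑ π : Finpartition (Finset.univ : Finset (Fin w.length)) with IsNonCrossing π.parts,
    coeffProd f w π * coeffProd g w (kreweras π)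

theorem coeffProd_of_length_eq_one (f : Word s n → R) (w : Word s n) (hw : w.length = 1)
    (π : Finpartition (Finset.univ : Finset (Fin w.length))) : coeffProd f w π = f w := by
  obtain ⟨l, hl, hln⟩ := w
  obtain ⟨i, rfl⟩ := List.length_eq_one_iff.1 hw
  have hV : ∀ V ∈ π.parts, V = {(0 : Fin 1)} := fun V hV => by
    obtain ⟨x, hx⟩ := π.nonempty_of_mem_parts hV
    ext y
    have hxy : y = x := Subsingleton.elim (α := Fin 1) y x
    have hy0 : y = (0 : Fin 1) := Subsingleton.elim (α := Fin 1) y 0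
    simp only [Finset.mem_singleton]
    exact ⟨fun _ => hy0, fun _ => hxy ▸ hx⟩
  have hp : π.part (0 : Fin 1) ∈ π.parts := π.part_mem.2 (Finset.mem_univ _)
  have : Unique {V // V ∈ π.parts} :=
    { default := ⟨_, hp⟩
      uniq := fun V => Subtype.ext ((hV _ V.2).trans (hV _ hp).symm) }
  refine (Fintype.prod_unique _).trans (congrArg f ?_)
  apply Subtype.ext
  have h0 := hV _ (default : {V // V ∈ π.parts}).2
  change ((default : {V // V ∈ π.parts}).1.sort).map [i].get = [i]
  rw [h0]
  simp

theorem boxConv_of_length_eq_one (f g : Word s n → R) (w : Word s n) (hw : w.length = 1) :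
    boxConv f g w = f w * g w := by
  simp only [boxConv, coeffProd_of_length_eq_one _ w hw, Finset.sum_const]
  obtain ⟨l, hl, hln⟩ := w
  obtain ⟨i, rfl⟩ := List.length_eq_one_iff.1 hw
  have : (Finset.univ.filter fun π : Finpartition (Finset.univ : Finset (Fin 1)) =>
      IsNonCrossing π.parts).card = 1 := by decide
  exact (congrArg (· • _) this).trans (one_smul _ _)

theorem map_boxConv {R' : Type*} [CommRing R'] (φ : R →+* R') (f g : Word s n → R) :
    φ ∘ boxConv f g = boxConv (φ ∘ f) (φ ∘ g) := by
  funext w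
  simp [boxConv, coeffProd, map_sum, map_prod]

theorem boxConv_comp_incl {m n : ℕ∞} (h : m ≤ n) (f g : Word s n → R) :
    boxConv f g ∘ Word.incl h = boxConv (f ∘ Word.incl h) (g ∘ Word.incl h) := rfl

/-- The set `(𝔊ˢ)ₙ(R)` of series with `f_i ∈ Rˣ` for all letters `i`; this is `𝔊ˢ(R)` if `n = ⊤`. -/
def GSet (s : ℕ) (n : ℕ∞) (R : Type*) [CommRing R] : Type _ :=
  {f : Word s n → R // ∀ w : Word s n, w.length = 1 → IsUnit (f w)}

/-- The set `(𝔊ˢ₊)ₙ(R)` of series with `f_i = 1` for all letters `i`; this is `𝔊ˢ₊(R)` if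
`n = ⊤`. -/
def GPlusSet (s : ℕ) (n : ℕ∞) (R : Type*) [CommRing R] : Type _ :=
  {f : Word s n → R // ∀ w : Word s n, w.length = 1 → f w = 1}

instance : Mul (GSet s n R) where
  mul f g := ⟨boxConv f.1 g.1, fun w hw => by
    rw [boxConv_of_length_eq_one _ _ w hw]; exact (f.2 w hw).mul (g.2 w hw)⟩

instance : Mul (GPlusSet s n R) where
  mul f g := ⟨boxConv f.1 g.1, fun w hw => by
    rw [boxConv_of_length_eq_one _ _ w hw, f.2 w hw, g.2 w hw, one_mul]⟩

end Box

/-! ### The `k`-functors, with the binary operation `⊠` -/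

section Functors

variable (k : Type u) [CommRing k] (s : ℕ)

/-- The `k`-functor `(𝔊ˢ)ₙ` with the operation `⊠`; this is `𝔊ˢ` if `n = ⊤`. -/
def G (n : ℕ∞) : CommAlgCat.{u} k ⥤ MagmaCat.{u} where
  obj R := MagmaCat.of (GSet s n R)
  map {R R'} φ := MagmaCat.ofHom
    { toFun := fun f => ⟨φ.hom ∘ f.1, fun w hw => (f.2 w hw).map φ.hom⟩
      map_mul' := fun f g => Subtype.ext (map_boxConv (φ.hom : R →+* R') f.1 g.1) }

/-- The `k`-functor `(𝔊ˢ₊)ₙ` with the operation `⊠`; this is `𝔊ˢ₊` if `n = ⊤`. -/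
def GPlus (n : ℕ∞) : CommAlgCat.{u} k ⥤ MagmaCat.{u} where
  obj R := MagmaCat.of (GPlusSet s n R)
  map {R R'} φ := MagmaCat.ofHom
    { toFun := fun f => ⟨φ.hom ∘ f.1, fun w hw =>
        (congrArg φ.hom (f.2 w hw)).trans (map_one φ.hom)⟩
      map_mul' := fun f g => Subtype.ext (map_boxConv (φ.hom : R →+* R') f.1 g.1) }

/-- The truncation `(𝔊ˢ)ₙ → (𝔊ˢ)ₘ`, `m ≤ n`. -/
def G.trunc {m n : ℕ∞} (h : m ≤ n) : G k s n ⟶ G k s m where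
  app R := MagmaCat.ofHom
    { toFun := fun f => (⟨f.1 ∘ Word.incl h, fun w hw => f.2 (w.incl h) hw⟩ : GSet s m R)
      map_mul' := fun f g => Subtype.ext (boxConv_comp_incl h f.1 g.1) }

/-- The truncation `(𝔊ˢ₊)ₙ → (𝔊ˢ₊)ₘ`, `m ≤ n`. -/
def GPlus.trunc {m n : ℕ∞} (h : m ≤ n) : GPlus k s n ⟶ GPlus k s m where
  app R := MagmaCat.ofHom
    { toFun := fun f => (⟨f.1 ∘ Word.incl h, fun w hw => f.2 (w.incl h) hw⟩ : GPlusSet s m R)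
      map_mul' := fun f g => Subtype.ext (boxConv_comp_incl h f.1 g.1) }

/-- The inverse system `((𝔊ˢ)ₙ)_{n ≥ 1}` with the truncations as transition maps. -/
def G.system : ℕ+ᵒᵖ ⥤ (CommAlgCat.{u} k ⥤ MagmaCat.{u}) where
  obj j := G k s ((j.unop : ℕ) : ℕ∞)
  map {i j} f := G.trunc k s (by
    have h : (j.unop : ℕ) ≤ (i.unop : ℕ) := leOfHom f.unop
    exact_mod_cast h)

/-- `𝔊ˢ` as a cone over the inverse system `((𝔊ˢ)ₙ)_{n ≥ 1}`, with the natural truncations. -/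
def G.cone : Cone (G.system k s) where
  pt := G k s ⊤
  π := { app := fun _ => G.trunc k s le_top }

/-- The inverse system `((𝔊ˢ₊)ₙ)_{n ≥ 1}` with the truncations as transition maps. -/
def GPlus.system : ℕ+ᵒᵖ ⥤ (CommAlgCat.{u} k ⥤ MagmaCat.{u}) where
  obj j := GPlus k s ((j.unop : ℕ) : ℕ∞)
  map {i j} f := GPlus.trunc k s (by
    have h : (j.unop : ℕ) ≤ (i.unop : ℕ) := leOfHom f.unop
    exact_mod_cast h)

/-- `𝔊ˢ₊` as a cone over the inverse system `((𝔊ˢ₊)ₙ)_{n ≥ 1}`, with the natural truncations. -/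
def GPlus.cone : Cone (GPlus.system k s) where
  pt := GPlus k s ⊤
  π := { app := fun _ => GPlus.trunc k s le_top }

end Functors

/-! ### Affine group schemes and their linear representations -/

section GroupSchemes

variable {k : Type u} [CommRing k]

/-- The Hopf algebra `A` with the element `a ∈ F(A)` represents the `k`-functor `F`, such that the
operation of `F` corresponds to the convolution product on `Hom(A, R)`. As convolution is a group
law on `Hom(A, R)`, it follows that all `F(R)` are groups, that is, `F` is an affine group scheme
with co-ordinate algebra `A`. -/
structure Represents (F : CommAlgCat.{u} k ⥤ MagmaCat.{u}) (A : Type u) [CommRing A]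
    [HopfAlgebra k A] (a : F.obj (CommAlgCat.of k A)) : Prop where
  bijective : ∀ (R : Type u) [CommRing R] [Algebra k R],
    Function.Bijective fun φ : A →ₐ[k] R => F.map (CommAlgCat.ofHom φ) a
  map_conv : ∀ (R : Type u) [CommRing R] [Algebra k R] (φ ψ : A →ₐ[k] R),
    F.map (CommAlgCat.ofHom (WithConv.toConv φ * WithConv.toConv ψ).ofConv) a =
      (F.map (CommAlgCat.ofHom φ) a * F.map (CommAlgCat.ofHom ψ) a : F.obj (CommAlgCat.of k R))

/-- A right comodule structure on `V` over the coalgebra `A`. -/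
structure Comodule (k : Type u) [CommRing k] (A : Type u) [CommRing A] [HopfAlgebra k A]
    (V : Type v) [AddCommGroup V] [Module k V] where
  coact : V →ₗ[k] V ⊗[k] A
  coassoc : (TensorProduct.assoc k V A A).toLinearMap ∘ₗ coact.rTensor A ∘ₗ coact =
    (Coalgebra.comul (R := k) (A := A)).lTensor V ∘ₗ coact
  counit : (TensorProduct.rid k V).toLinearMap ∘ₗ
    (Coalgebra.counit (R := k) (A := A)).lTensor V ∘ₗ coact = LinearMap.id

/-- `F` is an affine group scheme: it is represented by a (commutative) Hopf algebra. -/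
def IsAffineGroupScheme (F : CommAlgCat.{u} k ⥤ MagmaCat.{u}) : Prop :=
  ∃ (A : Type u) (_ : CommRing A) (_ : HopfAlgebra k A) (a : F.obj (CommAlgCat.of k A)),
    Represents F A a

/-- `F` is an algebraic group: an affine group scheme with finitely generated co-ordinate
algebra. -/
def IsAlgebraicGroup (F : CommAlgCat.{u} k ⥤ MagmaCat.{u}) : Prop :=
  ∃ (A : Type u) (_ : CommRing A) (_ : HopfAlgebra k A) (a : F.obj (CommAlgCat.of k A)),
    Represents F A a ∧ Algebra.FiniteType k A

/-- `F` is a unipotent affine group scheme: every non-zero comodule over its co-ordinate algebra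
has a non-zero fixed vector. (The co-ordinate Hopf algebra is unique up to isomorphism.) -/
def IsUnipotent (F : CommAlgCat.{u} k ⥤ MagmaCat.{u}) : Prop :=
  ∃ (A : Type u) (_ : CommRing A) (_ : HopfAlgebra k A) (a : F.obj (CommAlgCat.of k A)),
    Represents F A a ∧
    ∀ (V : Type v) [AddCommGroup V] [Module k V] [Nontrivial V] (ρ : Comodule k A V),
      ∃ x : V, x ≠ 0 ∧ ρ.coact x = x ⊗ₜ[k] (1 : A)

/-- `F` is a trigonalisable affine group scheme: every non-zero comodule over its co-ordinate
algebra has a one-dimensional invariant subspace. -/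
def IsTrigonalisable (F : CommAlgCat.{u} k ⥤ MagmaCat.{u}) : Prop :=
  ∃ (A : Type u) (_ : CommRing A) (_ : HopfAlgebra k A) (a : F.obj (CommAlgCat.of k A)),
    Represents F A a ∧
    ∀ (V : Type v) [AddCommGroup V] [Module k V] [Nontrivial V] (ρ : Comodule k A V),
      ∃ x : V, x ≠ 0 ∧ ∃ b : A, ρ.coact x = x ⊗ₜ[k] b

/-- `F` is a pro-unipotent affine group scheme: it is the limit of a directed inverse system of
unipotent algebraic groups. -/
def IsProUnipotent (F : CommAlgCat.{u} k ⥤ MagmaCat.{u}) : Prop :=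
  IsAffineGroupScheme F ∧
  ∃ (J : Type) (_ : Preorder J) (_ : IsDirectedOrder J) (_ : Nonempty J)
    (H : Jᵒᵖ ⥤ (CommAlgCat.{u} k ⥤ MagmaCat.{u})) (c : Cone H),
    (∀ j, IsAlgebraicGroup (H.obj j) ∧ IsUnipotent.{u, v} (H.obj j)) ∧
    Nonempty (IsLimit c) ∧ Nonempty (c.pt ≅ F)

end GroupSchemes

end FreeBox

/-! The boxed convolution is a group law because of two facts about the Kreweras complement, here
`kr`, relative to a non-crossing `Q`. A non-crossing `P ≤ Q` can be recovered from the relative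
complement `Q ⊓ kr P` (`sameBlock_iff_of_lt`), and `kr Q = kr P ⊓ kr (Q ⊓ kr P)` (`kr_eq_inf`).
Hence, for fixed `P`, the map `Q ↦ Q ⊓ kr P` is a bijection from the non-crossing partitions above
`P` onto those below `kr P`. This matches the two triple sums in the associativity law
(`setBox_assoc`). The series with coefficient one at each letter and zero elsewhere is a left unit.
Left inverses are found by recursion on the length of the word, since the top coefficient enters
multiplied only by letter coefficients, which are units.

Both functors are represented by a monoid algebra `k[N × (LongWord →₀ ℕ)]`. For `G`, `N` is free
abelian on the letters, which gives Laurent monomials; for `GPlus`, `N` is trivial. By Yoneda the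
group law makes this algebra a Hopf algebra with `Δ X_w = ∑ X_{w,π} ⊗ X_{w,K(π)}`. It is finitely
generated if words have bounded length.

Unipotence and trigonalisability both follow from a weight on monomials that gives letters weight
zero and longer words rapidly growing weights. The comultiplication does not increase total weight,
and monomials of weight zero are group-like. A coefficient vector of top weight in a comodule then
has a coaction supported in weight zero, and a further coefficient of it spans an invariant line
(`Comodule.exists_coact_eq_tmul`). For `GPlus` the only monomial of weight zero is `1`, so this
vector is fixed.

The inverse limits are formal: every word is finite, so a series is the same as a compatible family
of its truncations. -/

namespace FreeBox

/-! ### Non-crossing partitions and relative Kreweras complements -/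

section Combinatorics

variable {α : Type*} [LinearOrder α] {V : Finset α}

/-- The elements `x` and `y` lie in the same block of `P`. -/
def SameBlock (P : Finpartition V) (x y : α) : Prop := ∃ U ∈ P.parts, x ∈ U ∧ y ∈ U

theorem SameBlock.symm {P : Finpartition V} {x y : α} (h : SameBlock P x y) : SameBlock P y x :=
  let ⟨U, hU, hx, hy⟩ := h; ⟨U, hU, hy, hx⟩

theorem SameBlock.trans {P : Finpartition V} {x y z : α} (h : SameBlock P x y)
    (h' : SameBlock P y z) : SameBlock P x z := by
  obtain ⟨U, hU, hx, hy⟩ := h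
  obtain ⟨W, hW, hy', hz⟩ := h'
  obtain rfl := P.eq_of_mem_parts hU hW hy hy'
  exact ⟨U, hU, hx, hz⟩

theorem SameBlock.mem_left {P : Finpartition V} {x y : α} (h : SameBlock P x y) : x ∈ V :=
  let ⟨_, hU, hx, _⟩ := h; P.subset hU hx

theorem SameBlock.mem_right {P : Finpartition V} {x y : α} (h : SameBlock P x y) : y ∈ V :=
  h.symm.mem_left

theorem SameBlock.refl (P : Finpartition V) {x : α} (h : x ∈ V) : SameBlock P x x :=
  let ⟨U, hU, hx⟩ := P.exists_mem h; ⟨U, hU, hx, hx⟩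

theorem sameBlock_iff_mem {P : Finpartition V} {U : Finset α} (hU : U ∈ P.parts) {x y : α}
    (hx : x ∈ U) : SameBlock P x y ↔ y ∈ U :=
  ⟨fun ⟨W, hW, hx', hy⟩ => by rwa [P.eq_of_mem_parts hU hW hx hx'], fun hy => ⟨U, hU, hx, hy⟩⟩

theorem le_iff_sameBlock {P Q : Finpartition V} :
    P ≤ Q ↔ ∀ x y, SameBlock P x y → SameBlock Q x y := by
  constructor
  · rintro h x y ⟨U, hU, hx, hy⟩
    obtain ⟨W, hW, hUW⟩ := h hU
    exact ⟨W, hW, hUW hx, hUW hy⟩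
  · intro h U hU
    obtain ⟨x, hx⟩ := P.nonempty_of_mem_parts hU
    obtain ⟨W, hW, hxW⟩ := Q.exists_mem (P.subset hU hx)
    exact ⟨W, hW, fun y hy => (sameBlock_iff_mem hW hxW).1 (h x y ⟨U, hU, hx, hy⟩)⟩

theorem finpartition_ext {P Q : Finpartition V}
    (h : ∀ x y, SameBlock P x y ↔ SameBlock Q x y) : P = Q :=
  le_antisymm (le_iff_sameBlock.2 fun x y => (h x y).1) (le_iff_sameBlock.2 fun x y => (h x y).2)

theorem sameBlock_inf {P Q : Finpartition V} {x y : α} :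
    SameBlock (P ⊓ Q) x y ↔ SameBlock P x y ∧ SameBlock Q x y := by
  constructor
  · exact fun h => ⟨le_iff_sameBlock.1 inf_le_left _ _ h, le_iff_sameBlock.1 inf_le_right _ _ h⟩
  · rintro ⟨⟨U, hU, hx, hy⟩, ⟨W, hW, hx', hy'⟩⟩
    refine ⟨U ∩ W, ?_, by simp [hx, hx'], by simp [hy, hy']⟩
    rw [Finpartition.parts_inf, Finset.mem_erase]
    refine ⟨Finset.nonempty_iff_ne_empty.1 ⟨x, by simp [hx, hx']⟩, ?_⟩
    exact Finset.mem_image.2 ⟨(U, W), Finset.mem_product.2 ⟨hU, hW⟩, rfl⟩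

theorem sameBlock_bot {x y : α} : SameBlock (⊥ : Finpartition V) x y ↔ x ∈ V ∧ x = y := by
  constructor
  · rintro ⟨U, hU, hx, hy⟩
    obtain ⟨a, ha, rfl⟩ := Finpartition.mem_bot_iff.1 hU
    simp_all
  · rintro ⟨h, rfl⟩
    exact .refl _ h

theorem sameBlock_top {x y : α} : SameBlock (⊤ : Finpartition V) x y ↔ x ∈ V ∧ y ∈ V := by
  constructor
  · exact fun h => ⟨h.mem_left, h.mem_right⟩
  · rintro ⟨hx, hy⟩
    obtain ⟨U, hU, hxU⟩ := (⊤ : Finpartition V).exists_mem hx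
    have : U = V := by simpa using Finpartition.parts_top_subset V hU
    exact ⟨U, hU, hxU, this ▸ hy⟩

theorem sameBlock_bind {P : Finpartition V} {Q : ∀ U ∈ P.parts, Finpartition U} {x y : α} :
    SameBlock (P.bind Q) x y ↔ ∃ U, ∃ hU : U ∈ P.parts, SameBlock (Q U hU) x y := by
  constructor
  · rintro ⟨W, hW, hx, hy⟩
    obtain ⟨U, hU, h⟩ := Finpartition.mem_bind.1 hW
    exact ⟨U, hU, W, h, hx, hy⟩
  · rintro ⟨U, hU, W, h, hx, hy⟩
    exact ⟨W, Finpartition.mem_bind.2 ⟨U, hU, h⟩, hx, hy⟩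

open Classical in
theorem sameBlock_ofSetSetoid {r : Setoid α} {x y : α} :
    SameBlock (Finpartition.ofSetSetoid r V) x y ↔ x ∈ V ∧ y ∈ V ∧ r x y := by
  rw [← Finpartition.mem_part_ofSetSetoid_iff_rel, Finpartition.mem_part_iff_exists]
  exact ⟨fun ⟨U, hU, hx, hy⟩ => ⟨U, hU, hy, hx⟩, fun ⟨U, hU, hx, hy⟩ => ⟨U, hU, hy, hx⟩⟩

theorem isNonCrossing_iff {P : Finpartition V} : IsNonCrossing P.parts ↔
    ∀ a b c d, a < b → b < c → c < d → SameBlock P a c → SameBlock P b d → SameBlock P a b := by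
  constructor
  · rintro h a b c d hab hbc hcd ⟨U, hU, ha, hc⟩ ⟨W, hW, hb, hd⟩
    obtain rfl := h U hU W hW a ha b hb c hc d hd hab hbc hcd
    exact ⟨U, hU, ha, hb⟩
  · intro h U hU W hW a ha b hb c hc d hd hab hbc hcd
    have := h a b c d hab hbc hcd ⟨U, hU, ha, hc⟩ ⟨W, hW, hb, hd⟩
    exact P.eq_of_mem_parts hU hW ((sameBlock_iff_mem hU ha).1 this) hb

/-- The interval `(i, j]` (or `(j, i]`) is a union of blocks of `P` and of points outside `V`. -/
def Cuts (P : Finpartition V) (i j : α) : Prop :=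
  ∀ x y, SameBlock P x y → ((i < x ↔ j < x) ↔ (i < y ↔ j < y))

/-- The relation `Cuts P` as a setoid. -/
def cutsSetoid (P : Finpartition V) : Setoid α where
  r := Cuts P
  iseqv :=
    { refl := fun _ _ _ _ => by simp
      symm := fun h x y hxy => by have := h x y hxy; tauto
      trans := fun h h' x y hxy => by
        have h1 := h x y hxy
        have h2 := h' x y hxy
        tauto }

open Classical in
/-- The Kreweras complement of a partition of a finite subset of a linear order. -/
noncomputable def kr (P : Finpartition V) : Finpartition V :=
  Finpartition.ofSetSetoid (cutsSetoid P) V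

theorem sameBlock_kr {P : Finpartition V} {i j : α} :
    SameBlock (kr P) i j ↔ i ∈ V ∧ j ∈ V ∧ Cuts P i j := sameBlock_ofSetSetoid

theorem cuts_iff_of_lt {P : Finpartition V} {i j : α} (h : i < j) :
    Cuts P i j ↔ ∀ x y, SameBlock P x y → i < x → x ≤ j → i < y ∧ y ≤ j := by
  constructor
  · intro H x y hxy h1 h2
    have := H x y hxy
    grind
  · intro H x y hxy
    have h1 := H x y hxy
    have h2 := H y x hxy.symm
    grind

theorem isNonCrossing_kr (P : Finpartition V) : IsNonCrossing (kr P).parts := by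
  rw [isNonCrossing_iff]
  intro a b c d hab hbc hcd hac hbd
  rw [sameBlock_kr] at *
  refine ⟨hac.1, hbd.1, fun x y hxy => ?_⟩
  have h1 := hac.2.2 x y hxy
  have h2 := hbd.2.2 x y hxy
  grind

theorem isNonCrossing_inf {P Q : Finpartition V} (hP : IsNonCrossing P.parts)
    (hQ : IsNonCrossing Q.parts) : IsNonCrossing (P ⊓ Q).parts := by
  rw [isNonCrossing_iff] at *
  intro a b c d hab hbc hcd hac hbd
  rw [sameBlock_inf] at *
  exact ⟨hP a b c d hab hbc hcd hac.1 hbd.1, hQ a b c d hab hbc hcd hac.2 hbd.2⟩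

theorem isNonCrossing_top : IsNonCrossing (⊤ : Finpartition V).parts := by
  rw [isNonCrossing_iff]
  intro a b c d _ _ _ hac hbd
  exact sameBlock_top.2 ⟨hac.mem_left, hbd.mem_left⟩

theorem isNonCrossing_bot : IsNonCrossing (⊥ : Finpartition V).parts := by
  rw [isNonCrossing_iff]
  intro a b c d hab hbc _ hac _
  exact absurd (sameBlock_bot.1 hac).2 (hab.trans hbc).ne

/-- A block of a non-crossing partition does not separate points of another block. -/
theorem IsNonCrossing.not_separate {P : Finpartition V} (hP : IsNonCrossing P.parts) {a b x y : α}
    (hab : SameBlock P a b) (hxy : SameBlock P x y) (h : ¬ SameBlock P a x) :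
    (a < x ↔ b < x) ↔ (a < y ↔ b < y) := by
  rw [isNonCrossing_iff] at hP
  have hne : ∀ u v, SameBlock P a u → SameBlock P x v → u ≠ v := by
    rintro u v h1 h2 rfl
    exact h (h1.trans h2.symm)
  have ha := SameBlock.refl P hab.mem_left
  have hx := SameBlock.refl P hxy.mem_left
  have n1 := hne a x ha hx
  have n2 := hne a y ha hxy
  have n3 := hne b x hab hx
  have n4 := hne b y hab hxy
  have key : ∀ a b x y, SameBlock P a b → SameBlock P x y → ¬ SameBlock P a x →
      a < x → x < b → (y < a ∨ b < y) → False := by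
    rintro a b x y hab hxy h h1 h2 (h3 | h3)
    · exact h ((hP y a x b h3 h1 h2 hxy.symm hab).symm.trans hxy.symm)
    · exact h (hP a x b y h1 h2 h3 hab hxy)
  have k1 := key a b x y hab hxy h
  have k2 := key b a x y hab.symm hxy (fun h' => h (hab.trans h'))
  have k3 := key a b y x hab hxy.symm (fun h' => h (h'.trans hxy.symm))
  have k4 := key b a y x hab.symm hxy.symm (fun h' => h (hab.trans (h'.trans hxy.symm)))
  clear key hne hP
  have := n1.lt_or_gt
  have := n2.lt_or_gt
  have := n3.lt_or_gt
  have := n4.lt_or_gt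
  grind

/-- Blocks of `P` inside other blocks of `Q` are never separated by `a` and `b`, because `Q` is
non-crossing. So `Cuts` has to be tested only inside the `Q`-block containing `a` and `b`. -/
theorem cuts_of_le {P Q : Finpartition V} (hQ : IsNonCrossing Q.parts) (h : P ≤ Q) {a b : α}
    (hab : SameBlock Q a b)
    (H : ∀ x y, SameBlock P x y → SameBlock Q a x → ((a < x ↔ b < x) ↔ (a < y ↔ b < y))) :
    Cuts P a b := by
  intro x y hxy
  by_cases hax : SameBlock Q a x
  · exact H x y hxy hax
  · exact hQ.not_separate hab (le_iff_sameBlock.1 h _ _ hxy) hax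

open Classical in
theorem exists_max_of_mem {p : α → Prop} {a : α} (ha : a ∈ V) (hpa : p a) :
    ∃ m ∈ V, p m ∧ ∀ x ∈ V, p x → x ≤ m := by
  have hne : (V.filter p).Nonempty := ⟨a, by simp [ha, hpa]⟩
  obtain ⟨m, hm, h⟩ := (V.filter p).exists_maximal hne
  rw [Finset.mem_filter] at hm
  refine ⟨m, hm.1, hm.2, fun x hx hpx => ?_⟩
  have := h (Finset.mem_filter.2 ⟨hx, hpx⟩)
  exact le_of_not_gt fun h' => absurd (this h'.le) (not_le.2 h')

theorem exists_min_of_mem {p : α → Prop} {a : α} (ha : a ∈ V) (hpa : p a) :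
    ∃ m ∈ V, p m ∧ ∀ x ∈ V, p x → m ≤ x := by
  obtain ⟨m, hm, h⟩ := exists_max_of_mem (α := αᵒᵈ) (V := V) (p := p) ha hpa
  exact ⟨m, hm, h⟩

/-- A non-crossing partition `P ≤ Q` is recovered from `Q ⊓ kr P`. -/
theorem sameBlock_iff_of_lt {P Q : Finpartition V} (hP : IsNonCrossing P.parts)
    (hQ : IsNonCrossing Q.parts) (hPQ : P ≤ Q) {i j : α} (hij : i < j) :
    SameBlock P i j ↔ SameBlock Q i j ∧ ∀ x y, SameBlock (Q ⊓ kr P) x y → i ≤ x → x < j →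
      i ≤ y ∧ y < j := by
  constructor
  · refine fun h => ⟨le_iff_sameBlock.1 hPQ _ _ h, fun x y hxy h1 h2 => ?_⟩
    have := (sameBlock_kr.1 (sameBlock_inf.1 hxy).2).2.2 i j h
    grind
  · rintro ⟨hQij, H⟩
    by_contra hn
    have hiV := hQij.mem_left
    have hjV := hQij.mem_right
    have le := le_iff_sameBlock.1 hPQ
    have hii := SameBlock.refl P hiV
    -- It suffices to find a pair in one block of `Q ⊓ kr P` with exactly one member in `[i, j)`.
    -- One member will be `v`, the last element of the `P`-block of `i` before `j`. The other is
    -- `p`, the cyclic predecessor, within the `Q`-block, of the cyclic successor of `v` in its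
    -- `P`-block.
    have kill : ∀ a b, SameBlock Q i a → SameBlock Q i b → Cuts P a b → i ≤ a → a < j →
        (b < i ∨ j ≤ b) → False := by
      intro a b ha hb hc h1 h2 h3
      have := H a b (sameBlock_inf.2 ⟨ha.symm.trans hb, sameBlock_kr.2
        ⟨ha.mem_right, hb.mem_right, hc⟩⟩) h1 h2
      grind
    obtain ⟨v, hv, ⟨hiv, hvj⟩, hvmax⟩ :=
      exists_max_of_mem (p := fun x => SameBlock P i x ∧ x < j) hiV ⟨hii, hij⟩
    have hivle : i ≤ v := hvmax i hiV ⟨hii, hij⟩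
    have cross : ∀ a b x y, SameBlock P i a → SameBlock P i b → SameBlock P x y →
        ¬ SameBlock P i x → a < x → x < b → a < y ∧ y < b := by
      intro a b x y ha hb hxy hx h1 h2
      have hax : ¬ SameBlock P a x := fun h => hx (ha.trans h)
      have := hP.not_separate (ha.symm.trans hb) hxy hax
      have : y ≠ a := by rintro rfl; exact hax hxy.symm
      have : y ≠ b := by rintro rfl; exact hx (hb.trans hxy.symm)
      grind
    -- If the `P`-block continues beyond `j`, the successor of `v` is its first element `v'` after
    -- `j`. Otherwise the successor wraps around to the minimum `w` of the `P`-block.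
    by_cases hu : ∃ u, SameBlock P i u ∧ j < u
    · obtain ⟨u, hu, hju⟩ := hu
      obtain ⟨v', hv', ⟨hiv', hjv'⟩, hvmin⟩ :=
        exists_min_of_mem (p := fun x => SameBlock P i x ∧ j < x) hu.mem_right ⟨hu, hju⟩
      obtain ⟨p, hp, ⟨hip, hpv⟩, hpmax⟩ :=
        exists_max_of_mem (p := fun x => SameBlock Q i x ∧ x < v') hjV ⟨hQij, hjv'⟩
      have hjp := hpmax j hjV ⟨hQij, hjv'⟩
      refine kill v p (le _ _ hiv) hip ?_ hivle hvj (.inr hjp)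
      refine cuts_of_le hQ hPQ ((le _ _ hiv).symm.trans hip) ?_
      have key : ∀ x y, SameBlock P x y → SameBlock Q v x → v < x → x ≤ p → v < y ∧ y ≤ p := by
        intro x y hxy hvx h1 h2
        have hix : ¬ SameBlock P i x := by
          intro h
          rcases lt_trichotomy x j with h' | rfl | h'
          · exact absurd (hvmax x hxy.mem_left ⟨h, h'⟩) (not_le.2 h1)
          · exact hn h
          · exact absurd (hvmin x hxy.mem_left ⟨h, h'⟩) (by grind)
        have := cross v v' x y hiv hiv' hxy hix h1 (by grind)
        exact ⟨this.1, hpmax y hxy.mem_right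
          ⟨(le _ _ hiv).trans (hvx.trans (le _ _ hxy)), this.2⟩⟩
      intro x y hxy hvx
      have k1 := key x y hxy hvx
      have k2 := key y x hxy.symm (hvx.trans (le _ _ hxy))
      grind
    · have hvmax' : ∀ x, SameBlock P i x → x ≤ v := by
        intro x hx
        rcases lt_trichotomy x j with h' | rfl | h'
        · exact hvmax x hx.mem_right ⟨hx, h'⟩
        · exact absurd hx hn
        · exact absurd ⟨x, hx, h'⟩ hu
      obtain ⟨w, hw, hiw, hwmin⟩ := exists_min_of_mem (p := fun x => SameBlock P i x) hiV hii
      have hwi := hwmin i hiV hii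
      -- The predecessor of `w` in the `Q`-block is the largest element below `w` if there is one,
      -- and otherwise wraps around to the maximum of the `Q`-block.
      by_cases hq : ∃ q, SameBlock Q i q ∧ q < w
      · obtain ⟨q, hq, hqw⟩ := hq
        obtain ⟨p, hp, ⟨hip, hpw⟩, hpmax⟩ :=
          exists_max_of_mem (p := fun x => SameBlock Q i x ∧ x < w) hq.mem_right ⟨hq, hqw⟩
        refine kill v p (le _ _ hiv) hip ?_ hivle hvj (.inl (by grind))
        refine cuts_of_le hQ hPQ ((le _ _ hiv).symm.trans hip) ?_
        have key : ∀ x y, SameBlock P x y → SameBlock Q v x → p < x → x ≤ v → p < y ∧ y ≤ v := by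
          intro x y hxy hvx h1 h2
          have hwx : w ≤ x := by
            by_contra h
            exact absurd (hpmax x hxy.mem_left ⟨(le _ _ hiv).trans hvx, not_le.1 h⟩) (by grind)
          by_cases hix : SameBlock P i x
          · have := hvmax' y (hix.trans hxy)
            have := hwmin y hxy.mem_right (hix.trans hxy)
            grind
          · have h3 : x ≠ w := by rintro rfl; exact hix hiw
            have h4 : x ≠ v := by rintro rfl; exact hix hiv
            have := cross w v x y hiw hiv hxy hix (by grind) (by grind)
            grind
        intro x y hxy hvx
        have k1 := key x y hxy hvx
        have k2 := key y x hxy.symm (hvx.trans (le _ _ hxy))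
        grind
      · obtain ⟨p, hp, hip, hpmax⟩ := exists_max_of_mem (p := fun x => SameBlock Q i x) hjV hQij
        have hjp := hpmax j hjV hQij
        refine kill v p (le _ _ hiv) hip ?_ hivle hvj (.inr hjp)
        refine cuts_of_le hQ hPQ ((le _ _ hiv).symm.trans hip) ?_
        have key : ∀ x y, SameBlock P x y → SameBlock Q v x → v < x → x ≤ p → v < y ∧ y ≤ p := by
          intro x y hxy hvx h1 h2
          have hix : ¬ SameBlock P i x := fun h => absurd (hvmax' x h) (not_le.2 h1)
          have hQy : SameBlock Q i y := (le _ _ hiv).trans (hvx.trans (le _ _ hxy))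
          have hyp := hpmax y hQy.mem_right hQy
          refine ⟨?_, hyp⟩
          by_contra hyv
          have hwy : w ≤ y := not_lt.1 fun h => hq ⟨y, hQy, h⟩
          have hiy : ¬ SameBlock P i y := fun h => hix (h.trans hxy.symm)
          have h3 : y ≠ w := by rintro rfl; exact hiy hiw
          have h4 : y ≠ v := by rintro rfl; exact hiy hiv
          have := cross w v y x hiw hiv hxy.symm hiy (by grind) (by grind)
          grind
        intro x y hxy hvx
        have k1 := key x y hxy hvx
        have k2 := key y x hxy.symm (hvx.trans (le _ _ hxy))
        grind

theorem le_of_inf_kr_le {P P' Q : Finpartition V} (hP : IsNonCrossing P.parts)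
    (hP' : IsNonCrossing P'.parts) (hQ : IsNonCrossing Q.parts) (hPQ : P ≤ Q) (hPQ' : P' ≤ Q)
    (h : Q ⊓ kr P' ≤ Q ⊓ kr P) : P ≤ P' := by
  rw [le_iff_sameBlock] at h ⊢
  have key : ∀ i j, i < j → SameBlock P i j → SameBlock P' i j := by
    intro i j hij
    rw [sameBlock_iff_of_lt hP hQ hPQ hij, sameBlock_iff_of_lt hP' hQ hPQ' hij]
    exact fun ⟨h1, h2⟩ => ⟨h1, fun x y hxy => h2 x y (h x y hxy)⟩
  intro x y hxy
  rcases lt_trichotomy x y with h' | rfl | h'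
  · exact key x y h' hxy
  · exact .refl _ hxy.mem_left
  · exact (key y x h' hxy.symm).symm

theorem inf_kr_injective {P P' Q : Finpartition V} (hP : IsNonCrossing P.parts)
    (hP' : IsNonCrossing P'.parts) (hQ : IsNonCrossing Q.parts) (hPQ : P ≤ Q) (hPQ' : P' ≤ Q)
    (h : Q ⊓ kr P = Q ⊓ kr P') : P = P' :=
  le_antisymm (le_of_inf_kr_le hP hP' hQ hPQ hPQ' h.ge) (le_of_inf_kr_le hP' hP hQ hPQ' hPQ h.le)

theorem kr_antitone {P Q : Finpartition V} (h : P ≤ Q) : kr Q ≤ kr P := by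
  rw [le_iff_sameBlock] at *
  intro x y hxy
  rw [sameBlock_kr] at *
  exact ⟨hxy.1, hxy.2.1, fun a b hab => hxy.2.2 a b (h a b hab)⟩

theorem le_of_kr_le {P Q : Finpartition V} (hP : IsNonCrossing P.parts)
    (hQ : IsNonCrossing Q.parts) (h : kr Q ≤ kr P) : P ≤ Q :=
  le_of_inf_kr_le hP hQ isNonCrossing_top le_top le_top (inf_le_inf_left _ h)

theorem kr_injective {P Q : Finpartition V} (hP : IsNonCrossing P.parts)
    (hQ : IsNonCrossing Q.parts) (h : kr P = kr Q) : P = Q :=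
  le_antisymm (le_of_kr_le hP hQ h.ge) (le_of_kr_le hQ hP h.le)

/-- Surjectivity comes for free: an injective self-map of the finite set of non-crossing partitions
is onto. -/
theorem exists_kr_eq {P : Finpartition V} (hP : IsNonCrossing P.parts) :
    ∃ Q : Finpartition V, IsNonCrossing Q.parts ∧ kr Q = P := by
  let f : {Q : Finpartition V // IsNonCrossing Q.parts} →
      {Q : Finpartition V // IsNonCrossing Q.parts} :=
    fun Q => ⟨kr Q.1, isNonCrossing_kr Q.1⟩
  have hf : Function.Injective f := fun Q Q' h =>
    Subtype.ext (kr_injective Q.2 Q'.2 (congrArg Subtype.val h))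
  obtain ⟨Q, hQ⟩ := Finite.surjective_of_injective hf ⟨P, hP⟩
  exact ⟨Q.1, Q.2, congrArg Subtype.val hQ⟩

/-- Only the inclusion from right to left needs work. If an interval respects `P` but splits a block
of `Q`, then that block contains two points, one inside the interval and one outside, that are
joined by `Q ⊓ kr P`. -/
theorem kr_eq_inf {P Q : Finpartition V} (hQ : IsNonCrossing Q.parts) (hPQ : P ≤ Q) :
    kr Q = kr P ⊓ kr (Q ⊓ kr P) := by
  refine le_antisymm (le_inf (kr_antitone hPQ) (kr_antitone inf_le_left)) ?_
  rw [le_iff_sameBlock]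
  have le := le_iff_sameBlock.1 hPQ
  have key : ∀ i j, i < j → SameBlock (kr P ⊓ kr (Q ⊓ kr P)) i j → SameBlock (kr Q) i j := by
    intro i j hij h
    rw [sameBlock_inf, sameBlock_kr, sameBlock_kr, cuts_iff_of_lt hij, cuts_iff_of_lt hij] at h
    obtain ⟨⟨hi, hj, h1⟩, -, -, h2⟩ := h
    refine sameBlock_kr.2 ⟨hi, hj, (cuts_iff_of_lt hij).2 fun x y hxy hix hxj => ?_⟩
    by_contra hy
    have hxx := SameBlock.refl Q hxy.mem_left
    have kill : ∀ a b, SameBlock Q x a → SameBlock Q x b →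
        (∀ z w, SameBlock P z w → SameBlock Q a z → ((a < z ↔ b < z) ↔ (a < w ↔ b < w))) →
        i < a → a ≤ j → ¬ (i < b ∧ b ≤ j) → False := fun a b ha hb H h3 h4 h5 =>
      h5 (h2 a b (sameBlock_inf.2 ⟨ha.symm.trans hb, sameBlock_kr.2 ⟨ha.mem_right, hb.mem_right,
        cuts_of_le hQ hPQ (ha.symm.trans hb) H⟩⟩) h3 h4)
    -- The two points are `b`, the last element of the `Q`-block inside `(i, j]`, and `c`, the last
    -- element at or before `i`, or the maximum of the block if there is none. Within the `Q`-block,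
    -- the interval between `b` and `c` is the trace of `(i, j]` or of its complement, so it
    -- respects `P`.
    obtain ⟨b, hb, ⟨hxb, hbj⟩, hbmax⟩ :=
      exists_max_of_mem (p := fun z => SameBlock Q x z ∧ z ≤ j) hxy.mem_left ⟨hxx, hxj⟩
    have hxb' := hbmax x hxy.mem_left ⟨hxx, hxj⟩
    by_cases ha : ∃ a, SameBlock Q x a ∧ a ≤ i
    · obtain ⟨a, ha, hai⟩ := ha
      obtain ⟨c, hc, ⟨hxc, hci⟩, hcmax⟩ :=
        exists_max_of_mem (p := fun z => SameBlock Q x z ∧ z ≤ i) ha.mem_right ⟨ha, hai⟩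
      refine kill b c hxb hxc ?_ (by grind) hbj (by grind)
      have e : ∀ z, SameBlock Q x z → ((b < z ↔ c < z) ↔ ¬ (i < z ∧ z ≤ j)) := by
        intro z hz
        have := hbmax z hz.mem_right
        have := hcmax z hz.mem_right
        grind
      intro z w hzw hbz
      have hz := hxb.trans hbz
      rw [e z hz, e w (hz.trans (le _ _ hzw))]
      have k1 := h1 z w hzw
      have k2 := h1 w z hzw.symm
      grind
    · obtain ⟨c, hc, hxc, hcmax⟩ := exists_max_of_mem (p := fun z => SameBlock Q x z)
        hxy.mem_left hxx
      have hiy : i < y := not_le.1 fun h => ha ⟨y, hxy, h⟩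
      have hyc := hcmax y hxy.mem_right hxy
      refine kill b c hxb hxc ?_ (by grind) hbj (by grind)
      have e : ∀ z, SameBlock Q x z → ((b < z ↔ c < z) ↔ (i < z ∧ z ≤ j)) := by
        intro z hz
        have := hbmax z hz.mem_right
        have := hcmax z hz.mem_right
        have : i < z := not_le.1 fun h => ha ⟨z, hz, h⟩
        grind
      intro z w hzw hbz
      have hz := hxb.trans hbz
      rw [e z hz, e w (hz.trans (le _ _ hzw))]
      have k1 := h1 z w hzw
      have k2 := h1 w z hzw.symm
      grind
  intro x y hxy
  rcases lt_trichotomy x y with h' | rfl | h'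
  · exact key x y h' hxy
  · exact .refl _ hxy.mem_left
  · exact (key y x h' hxy.symm).symm

theorem kr_bot : kr (⊥ : Finpartition V) = ⊤ := by
  refine finpartition_ext fun x y => ?_
  rw [sameBlock_kr, sameBlock_top]
  refine ⟨fun h => ⟨h.1, h.2.1⟩, fun h => ⟨h.1, h.2, fun a b hab => ?_⟩⟩
  rw [(sameBlock_bot.1 hab).2]

theorem kr_top : kr (⊤ : Finpartition V) = ⊥ := by
  have key : ∀ x y, x < y → ¬ SameBlock (kr (⊤ : Finpartition V)) x y := by
    intro x y hxy h
    rw [sameBlock_kr, cuts_iff_of_lt hxy] at h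
    have := h.2.2 y x (sameBlock_top.2 ⟨h.2.1, h.1⟩) hxy le_rfl
    exact this.1.false
  refine finpartition_ext fun x y => ?_
  rw [sameBlock_bot]
  constructor
  · intro h
    refine ⟨h.mem_left, ?_⟩
    rcases lt_trichotomy x y with h' | h' | h'
    · exact absurd h (key x y h')
    · exact h'
    · exact absurd h.symm (key y x h')
  · rintro ⟨h, rfl⟩
    exact .refl _ h

end Combinatorics

/-! ### Boxed convolution of functions on finite subsets, and its associativity -/

section SetBox

variable {α : Type*} [LinearOrder α] {V : Finset α} {R : Type*} [CommRing R]

/-- The product of the values of `A` at the blocks of `P`. -/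
def blockProd (A : Finset α → R) (P : Finpartition V) : R := ∏ U ∈ P.parts, A U

/-- The boxed convolution of two functions of finite subsets of a linear order. -/
noncomputable def setBox (A B : Finset α → R) (V : Finset α) : R :=
  ∑ P : Finpartition V with IsNonCrossing P.parts, blockProd A P * blockProd B (kr P)

theorem blockProd_bind (A : Finset α → R) (P : Finpartition V)
    (Q : ∀ U ∈ P.parts, Finpartition U) :
    blockProd A (P.bind Q) = ∏ U ∈ P.parts.attach, blockProd A (Q U.1 U.2) := by
  unfold blockProd
  refine (Finset.prod_biUnion ?_)
  intro U _ W _ hUW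
  refine Finset.disjoint_left.2 fun Z hZ hZ' => hUW ?_
  obtain ⟨z, hz⟩ := (Q U.1 U.2).nonempty_of_mem_parts hZ
  exact Subtype.ext (P.eq_of_mem_parts U.2 W.2 ((Q U.1 U.2).subset hZ hz)
    ((Q W.1 W.2).subset hZ' hz))

theorem bind_le (P : Finpartition V) (Q : ∀ U ∈ P.parts, Finpartition U) : P.bind Q ≤ P := by
  rw [le_iff_sameBlock]
  intro x y h
  obtain ⟨U, hU, h⟩ := sameBlock_bind.1 h
  exact ⟨U, hU, h.mem_left, h.mem_right⟩

theorem sameBlock_bind_iff {P : Finpartition V} {Q : ∀ U ∈ P.parts, Finpartition U}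
    {U : Finset α} (hU : U ∈ P.parts) {x y : α} (hx : x ∈ U) :
    SameBlock (P.bind Q) x y ↔ SameBlock (Q U hU) x y := by
  rw [sameBlock_bind]
  refine ⟨fun ⟨W, hW, h⟩ => ?_, fun h => ⟨U, hU, h⟩⟩
  obtain rfl := P.eq_of_mem_parts hU hW hx h.mem_left
  exact h

theorem isNonCrossing_bind {P : Finpartition V} (hP : IsNonCrossing P.parts)
    {Q : ∀ U ∈ P.parts, Finpartition U} (hQ : ∀ U hU, IsNonCrossing (Q U hU).parts) :
    IsNonCrossing (P.bind Q).parts := by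
  rw [isNonCrossing_iff] at *
  intro a b c d hab hbc hcd hac hbd
  have le := le_iff_sameBlock.1 (bind_le P Q)
  obtain ⟨U, hU, haU, hbU⟩ := hP a b c d hab hbc hcd (le _ _ hac) (le _ _ hbd)
  rw [sameBlock_bind_iff hU haU] at hac ⊢
  rw [sameBlock_bind_iff hU hbU] at hbd
  exact isNonCrossing_iff.1 (hQ U hU) a b c d hab hbc hcd hac hbd

/-- Relative complements are computed block by block, since by `cuts_of_le` a block of the
non-crossing `P` does not see the refinement of the other blocks. -/
theorem kr_bind {P : Finpartition V} (hP : IsNonCrossing P.parts)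
    (Q : ∀ U ∈ P.parts, Finpartition U) :
    P ⊓ kr (P.bind Q) = P.bind fun U hU => kr (Q U hU) := by
  refine finpartition_ext fun x y => ?_
  rw [sameBlock_inf, sameBlock_bind, sameBlock_kr]
  constructor
  · rintro ⟨⟨U, hU, hx, hy⟩, -, -, h⟩
    refine ⟨U, hU, sameBlock_kr.2 ⟨hx, hy, fun a b hab => h a b ?_⟩⟩
    rwa [sameBlock_bind_iff hU hab.mem_left]
  · rintro ⟨U, hU, h⟩
    rw [sameBlock_kr] at h
    have hxy : SameBlock P x y := ⟨U, hU, h.1, h.2.1⟩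
    refine ⟨hxy, hxy.mem_left, hxy.mem_right, cuts_of_le hP (bind_le P Q) hxy ?_⟩
    intro a b hab hxa
    rw [sameBlock_iff_mem hU h.1] at hxa
    exact h.2.2 a b ((sameBlock_bind_iff hU hxa).1 hab)

theorem sameBlock_restrict {P : Finpartition V} {U : Finset α} (hU : U ≤ V) {x y : α} :
    SameBlock (P.restrict hU) x y ↔ x ∈ U ∧ y ∈ U ∧ SameBlock P x y := by
  constructor
  · rintro ⟨W, hW, hx, hy⟩
    obtain ⟨Z, hZ, rfl⟩ := Finset.mem_image.1 (Finset.mem_of_mem_erase hW)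
    simp only [Finset.inf_eq_inter, Finset.mem_inter] at hx hy
    exact ⟨hx.2, hy.2, Z, hZ, hx.1, hy.1⟩
  · rintro ⟨hx, hy, Z, hZ, hx', hy'⟩
    refine ⟨Z ⊓ U, Finset.mem_erase.2 ⟨?_, Finset.mem_image.2 ⟨Z, hZ, rfl⟩⟩,
      by simp [*], by simp [*]⟩
    exact Finset.nonempty_iff_ne_empty.1 ⟨x, by simp [*]⟩

theorem isNonCrossing_restrict {P : Finpartition V} (hP : IsNonCrossing P.parts) {U : Finset α}
    (hU : U ≤ V) : IsNonCrossing (P.restrict hU).parts := by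
  rw [isNonCrossing_iff] at *
  intro a b c d hab hbc hcd hac hbd
  rw [sameBlock_restrict] at *
  exact ⟨hac.1, hbd.1, hP a b c d hab hbc hcd hac.2.2 hbd.2.2⟩

open Classical in
/-- Non-crossing partitions of the blocks of `P` are the same as non-crossing refinements of `P`. -/
theorem blockProd_setBox (A B : Finset α → R) {P : Finpartition V} (hP : IsNonCrossing P.parts) :
    blockProd (setBox A B) P = ∑ Q : Finpartition V with IsNonCrossing Q.parts ∧ Q ≤ P,
      blockProd A Q * blockProd B (P ⊓ kr Q) := by
  unfold setBox
  rw [blockProd, Finset.prod_sum]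
  refine Finset.sum_bij' (fun Q _ => P.bind Q) (fun Q _ U hU => Q.restrict (P.le hU)) ?_ ?_ ?_ ?_ ?_
  · intro Q hQ
    simp only [Finset.mem_pi, Finset.mem_filter, Finset.mem_univ, true_and] at hQ ⊢
    exact ⟨isNonCrossing_bind hP hQ, bind_le P Q⟩
  · intro Q hQ
    simp only [Finset.mem_pi, Finset.mem_filter, Finset.mem_univ, true_and] at hQ ⊢
    exact fun U hU => isNonCrossing_restrict hQ.1 _
  · intro Q hQ
    funext U hU
    refine finpartition_ext fun x y => ?_
    rw [sameBlock_restrict]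
    constructor
    · rintro ⟨hx, hy, h⟩
      exact (sameBlock_bind_iff hU hx).1 h
    · intro h
      exact ⟨h.mem_left, h.mem_right, (sameBlock_bind_iff hU h.mem_left).2 h⟩
  · intro Q hQ
    simp only [Finset.mem_filter, Finset.mem_univ, true_and] at hQ
    refine finpartition_ext fun x y => ?_
    rw [sameBlock_bind]
    constructor
    · rintro ⟨U, hU, h⟩
      exact (sameBlock_restrict _).1 h |>.2.2
    · intro h
      obtain ⟨U, hU, hx, hy⟩ := le_iff_sameBlock.1 hQ.2 x y h
      exact ⟨U, hU, (sameBlock_restrict _).2 ⟨hx, hy, h⟩⟩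
  · intro Q hQ
    rw [kr_bind hP, blockProd_bind, blockProd_bind, Finset.prod_mul_distrib]

-- Both sides become sums over pairs of non-crossing partitions. On the left these are pairs `P ≤
-- Q`, on the right a `P` with a refinement of `kr P`. The substitution `Q ↦ Q ⊓ kr P` identifies
-- them term by term by `kr_eq_inf`.
open Classical in
theorem setBox_assoc (A B C : Finset α → R) (V : Finset α) :
    setBox (setBox A B) C V = setBox A (setBox B C) V := by
  have h1 : setBox (setBox A B) C V = ∑ P : Finpartition V with IsNonCrossing P.parts,
      ∑ Q : Finpartition V with IsNonCrossing Q.parts ∧ Q ≤ P,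
        blockProd A Q * blockProd B (P ⊓ kr Q) * blockProd C (kr P) := by
    rw [setBox]
    refine Finset.sum_congr rfl fun P hP => ?_
    rw [blockProd_setBox A B (Finset.mem_filter.1 hP).2, Finset.sum_mul]
  have h2 : setBox A (setBox B C) V = ∑ P : Finpartition V with IsNonCrossing P.parts,
      ∑ Q : Finpartition V with IsNonCrossing Q.parts ∧ Q ≤ kr P,
        blockProd A P * (blockProd B Q * blockProd C (kr P ⊓ kr Q)) := by
    rw [setBox]
    refine Finset.sum_congr rfl fun P hP => ?_
    rw [blockProd_setBox B C (isNonCrossing_kr P), Finset.mul_sum]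
  rw [h1, h2, Finset.sum_comm' (t' := Finset.univ.filter fun Q : Finpartition V =>
    IsNonCrossing Q.parts) (s' := fun Q => Finset.univ.filter fun P : Finpartition V =>
      IsNonCrossing P.parts ∧ Q ≤ P) (by simp; tauto)]
  refine Finset.sum_congr rfl fun P hP => ?_
  have hP : IsNonCrossing P.parts := by simpa using hP
  refine Finset.sum_bij (fun Q _ => Q ⊓ kr P) ?_ ?_ ?_ ?_
  · intro Q hQ
    simp only [Finset.mem_filter, Finset.mem_univ, true_and] at hQ ⊢
    exact ⟨isNonCrossing_inf hQ.1 (isNonCrossing_kr P), inf_le_right⟩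
  · intro Q hQ Q' hQ' h
    simp only [Finset.mem_filter, Finset.mem_univ, true_and] at hQ hQ' h
    refine kr_injective hQ.1 hQ'.1 ?_
    rw [kr_eq_inf hQ.1 hQ.2, kr_eq_inf hQ'.1 hQ'.2, h]
  · intro Q hQ
    simp only [Finset.mem_filter, Finset.mem_univ, true_and] at hQ
    -- The preimage `S` is forced by `kr_eq_inf`: its complement must be `kr P ⊓ kr Q`. Antitonicity
    -- then gives `P ≤ S`, and injectivity of the complement relative to `kr P` gives `S ⊓ kr P =
    -- Q`.
    obtain ⟨S, hS, hSQ⟩ := exists_kr_eq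
      (isNonCrossing_inf (isNonCrossing_kr P) (isNonCrossing_kr Q))
    have hPS : P ≤ S := le_of_kr_le hP hS (hSQ ▸ inf_le_left)
    refine ⟨S, by simp [hS, hPS], ?_⟩
    refine inf_kr_injective (isNonCrossing_inf hS (isNonCrossing_kr P)) hQ.1 (isNonCrossing_kr P)
      inf_le_right hQ.2 ?_
    rw [← kr_eq_inf hS hPS, hSQ]
  · intro Q hQ
    simp only [Finset.mem_filter, Finset.mem_univ, true_and] at hQ
    rw [kr_eq_inf hQ.1 hQ.2, mul_assoc]

/-- Blocks are non-empty, so values at `∅` do not matter. This is needed because `wordFun` vanishes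
at `∅`, while `setBox` there is the empty product. -/
theorem setBox_congr {A A' B B' : Finset α → R} {V : Finset α}
    (hA : ∀ U, U.Nonempty → A U = A' U) (hB : ∀ U, U.Nonempty → B U = B' U) :
    setBox A B V = setBox A' B' V := by
  refine Finset.sum_congr rfl fun P _ => congrArg₂ _ ?_ ?_
  · exact Finset.prod_congr rfl fun U hU => hA U (P.nonempty_of_mem_parts hU)
  · exact Finset.prod_congr rfl fun U hU => hB U ((kr P).nonempty_of_mem_parts hU)

/-- The unit of the boxed convolution. -/
def setDelta (U : Finset α) : R := if U.card = 1 then 1 else 0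

theorem blockProd_bot (A : Finset α → R) :
    blockProd A (⊥ : Finpartition V) = ∏ x ∈ V, A {x} := by
  rw [blockProd, Finpartition.parts_bot, Finset.prod_map]
  rfl

theorem parts_top_eq (hV : V.Nonempty) : (⊤ : Finpartition V).parts = {V} :=
  (Finset.subset_singleton_iff.1 (Finpartition.parts_top_subset V)).resolve_left fun h =>
    hV.ne_empty (Finpartition.parts_eq_empty_iff.1 h)

theorem blockProd_top (A : Finset α → R) (hV : V.Nonempty) :
    blockProd A (⊤ : Finpartition V) = A V := by
  rw [blockProd, parts_top_eq hV, Finset.prod_singleton]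

theorem blockProd_setDelta (P : Finpartition V) :
    blockProd setDelta P = if P = ⊥ then (1 : R) else 0 := by
  split_ifs with h
  · subst h
    rw [blockProd_bot]
    simp [setDelta]
  · have : ∃ U ∈ P.parts, U.card ≠ 1 := by
      by_contra! h'
      refine h (finpartition_ext fun x y => ?_)
      rw [sameBlock_bot]
      constructor
      · rintro ⟨U, hU, hx, hy⟩
        exact ⟨P.subset hU hx, Finset.card_le_one.1 (h' U hU).le x hx y hy⟩
      · rintro ⟨hx, rfl⟩
        exact .refl _ hx
    obtain ⟨U, hU, hU'⟩ := this
    exact Finset.prod_eq_zero hU (if_neg hU')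

theorem setDelta_setBox (A : Finset α → R) (hV : V.Nonempty) : setBox setDelta A V = A V := by
  unfold setBox
  rw [Finset.sum_eq_single_of_mem ⊥ (by simpa using isNonCrossing_bot)]
  · rw [blockProd_setDelta, if_pos rfl, one_mul, kr_bot, blockProd_top _ hV]
  · intro P _ hP
    rw [blockProd_setDelta, if_neg hP, zero_mul]

variable {β : Type*} [LinearOrder β]

/-- The image of a partition under an order embedding. -/
def mapPartition (e : β ↪o α) {W : Finset β} (P : Finpartition W) :
    Finpartition (W.map e.toEmbedding) where
  parts := P.parts.map (Finset.mapEmbedding e.toEmbedding).toEmbedding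
  supIndep := by
    rw [Finset.supIndep_iff_pairwiseDisjoint]
    intro U hU Z hZ h
    simp only [Finset.coe_map, Set.mem_image, Finset.mem_coe] at hU hZ
    obtain ⟨U, hU, rfl⟩ := hU
    obtain ⟨Z, hZ, rfl⟩ := hZ
    have : U ≠ Z := by rintro rfl; exact h rfl
    exact (Finset.disjoint_map e.toEmbedding).2 (P.disjoint hU hZ this)
  sup_parts := by
    ext x
    simp only [Finset.mem_sup, Finset.mem_map, id]
    constructor
    · rintro ⟨_, ⟨U, hU, rfl⟩, hx⟩
      obtain ⟨a, ha, rfl⟩ := Finset.mem_map.1 hx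
      exact ⟨a, P.subset hU ha, rfl⟩
    · rintro ⟨a, ha, rfl⟩
      obtain ⟨U, hU, haU⟩ := P.exists_mem ha
      exact ⟨_, ⟨U, hU, rfl⟩, Finset.mem_map_of_mem e.toEmbedding haU⟩
  bot_notMem := by
    intro h
    obtain ⟨U, hU, h⟩ := Finset.mem_map.1 h
    exact P.ne_empty hU (Finset.map_eq_empty.1 h)

theorem sameBlock_mapPartition (e : β ↪o α) {W : Finset β} {P : Finpartition W} {x y : β} :
    SameBlock (mapPartition e P) (e x) (e y) ↔ SameBlock P x y := by
  constructor
  · rintro ⟨_, hU, hx, hy⟩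
    obtain ⟨U, hU', rfl⟩ := Finset.mem_map.1 hU
    exact ⟨U, hU', (Finset.mem_map' e.toEmbedding).1 hx, (Finset.mem_map' e.toEmbedding).1 hy⟩
  · rintro ⟨U, hU, hx, hy⟩
    exact ⟨_, Finset.mem_map_of_mem _ hU, Finset.mem_map_of_mem e.toEmbedding hx,
      Finset.mem_map_of_mem e.toEmbedding hy⟩

theorem finpartition_map_ext {e : β ↪o α} {W : Finset β}
    {P Q : Finpartition (W.map e.toEmbedding)}
    (h : ∀ x y, SameBlock P (e x) (e y) ↔ SameBlock Q (e x) (e y)) : P = Q := by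
  refine finpartition_ext fun x y => ?_
  constructor
  · intro hxy
    obtain ⟨a, -, rfl⟩ := Finset.mem_map.1 hxy.mem_left
    obtain ⟨b, -, rfl⟩ := Finset.mem_map.1 hxy.mem_right
    exact (h a b).1 hxy
  · intro hxy
    obtain ⟨a, -, rfl⟩ := Finset.mem_map.1 hxy.mem_left
    obtain ⟨b, -, rfl⟩ := Finset.mem_map.1 hxy.mem_right
    exact (h a b).2 hxy

theorem isNonCrossing_mapPartition (e : β ↪o α) {W : Finset β} {P : Finpartition W} :
    IsNonCrossing (mapPartition e P).parts ↔ IsNonCrossing P.parts := by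
  rw [isNonCrossing_iff, isNonCrossing_iff]
  constructor
  · intro h a b c d hab hbc hcd hac hbd
    rw [← sameBlock_mapPartition e] at *
    exact h _ _ _ _ (e.lt_iff_lt.2 hab) (e.lt_iff_lt.2 hbc) (e.lt_iff_lt.2 hcd) hac hbd
  · intro h a b c d hab hbc hcd hac hbd
    obtain ⟨a, -, rfl⟩ := Finset.mem_map.1 hac.mem_left
    obtain ⟨b, -, rfl⟩ := Finset.mem_map.1 hbd.mem_left
    obtain ⟨c, -, rfl⟩ := Finset.mem_map.1 hac.mem_right
    obtain ⟨d, -, rfl⟩ := Finset.mem_map.1 hbd.mem_right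
    exact (sameBlock_mapPartition e).2 (h a b c d (e.lt_iff_lt.1 hab) (e.lt_iff_lt.1 hbc)
      (e.lt_iff_lt.1 hcd) ((sameBlock_mapPartition e).1 hac) ((sameBlock_mapPartition e).1 hbd))

theorem kr_mapPartition (e : β ↪o α) {W : Finset β} (P : Finpartition W) :
    kr (mapPartition e P) = mapPartition e (kr P) := by
  refine finpartition_map_ext fun x y => ?_
  rw [sameBlock_mapPartition, sameBlock_kr, sameBlock_kr]
  refine and_congr (Finset.mem_map' e.toEmbedding) (and_congr (Finset.mem_map' e.toEmbedding) ?_)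
  constructor
  · intro h a b hab
    have := h (e a) (e b) ((sameBlock_mapPartition e).2 hab)
    simpa using this
  · intro h a b hab
    obtain ⟨a, -, rfl⟩ := Finset.mem_map.1 hab.mem_left
    obtain ⟨b, -, rfl⟩ := Finset.mem_map.1 hab.mem_right
    have := h a b ((sameBlock_mapPartition e).1 hab)
    simpa using this

theorem mapPartition_bijective (e : β ↪o α) (W : Finset β) :
    Function.Bijective (mapPartition e (W := W)) := by
  classical
  constructor
  · intro P Q h
    refine finpartition_ext fun x y => ?_
    rw [← sameBlock_mapPartition e, ← sameBlock_mapPartition e, h]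
  · intro Q
    -- Equality is added to make the pulled-back relation reflexive at points outside `W`.
    let r : Setoid β :=
      { r := fun x y => x = y ∨ SameBlock Q (e x) (e y)
        iseqv :=
          { refl := fun x => .inl rfl
            symm := by
              rintro x y (rfl | h)
              exacts [.inl rfl, .inr h.symm]
            trans := by
              rintro x y z (rfl | h) (rfl | h')
              exacts [.inl rfl, .inr h', .inr h, .inr (h.trans h')] } }
    refine ⟨Finpartition.ofSetSetoid r W, finpartition_map_ext fun x y => ?_⟩
    have mem : ∀ x, x ∈ W ↔ e x ∈ W.map e.toEmbedding :=
      fun x => (Finset.mem_map' e.toEmbedding).symm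
    rw [sameBlock_mapPartition]
    refine (sameBlock_ofSetSetoid (r := r)).trans ?_
    constructor
    · rintro ⟨hx, hy, rfl | h⟩
      exacts [.refl _ ((mem x).1 hx), h]
    · intro h
      exact ⟨(mem x).2 h.mem_left, (mem y).2 h.mem_right, .inr h⟩

/-- The convolution depends only on the order type of the set. This lets the convolution at a
subword `w|V` be computed on `V` itself, inside the positions of `w`. -/
theorem setBox_map (e : β ↪o α) (A B : Finset α → R) (W : Finset β) :
    setBox A B (W.map e.toEmbedding) =
      setBox (fun U => A (U.map e.toEmbedding)) (fun U => B (U.map e.toEmbedding)) W := by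
  have hb : ∀ (A : Finset α → R) (P : Finpartition W), blockProd A (mapPartition e P) =
      blockProd (fun U => A (U.map e.toEmbedding)) P := fun A P => Finset.prod_map _ _ _
  refine (Finset.sum_bij (fun P _ => mapPartition e P) ?_ ?_ ?_ ?_).symm
  · intro P hP
    simpa [isNonCrossing_mapPartition] using hP
  · exact fun P _ Q _ h => (mapPartition_bijective e W).1 h
  · intro Q hQ
    obtain ⟨P, rfl⟩ := (mapPartition_bijective e W).2 Q
    exact ⟨P, by simpa [isNonCrossing_mapPartition] using hQ, rfl⟩
  · intro P _
    rw [hb, kr_mapPartition, hb]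

end SetBox

/-- Recursion on length: the iterates of `E` starting from zero are constant at `w` from step `len w
+ 1` on. -/
theorem exists_fixedPoint_of_lt {W R : Type*} [Zero R] (len : W → ℕ) (E : (W → R) → W → R)
    (hE : ∀ w h h', (∀ w', len w' < len w → h w' = h' w') → E h w = E h' w) :
    ∃ h, E h = h := by
  have key : ∀ N w, len w < N → ∀ m, len w < m → (E^[m] 0) w = (E^[len w + 1] 0) w := by
    intro N
    induction N with
    | zero => exact fun w h => absurd h (Nat.not_lt_zero _)
    | succ N ih =>
      intro w hw m hm
      obtain ⟨m, rfl⟩ := Nat.exists_eq_add_of_lt hm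
      rw [Function.iterate_succ_apply', Function.iterate_succ_apply']
      refine hE _ _ _ fun w' hw' => ?_
      rw [ih w' (by omega) (len w + m) (by omega), ih w' (by omega) (len w) hw']
  refine ⟨fun w => (E^[len w + 1] 0) w, funext fun w => ?_⟩
  rw [Function.iterate_succ_apply']
  exact hE _ _ _ fun w' hw' => (key _ w' (Nat.lt_succ_self _) _ hw').symm

/-! ### The group structure on series -/

section WordBox

variable {s : ℕ} {n : ℕ∞} {R : Type*} [CommRing R]

theorem Word.length_restrict (w : Word s n) (V : Finset (Fin w.length)) (hV : V.Nonempty) :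
    (w.restrict V hV).length = V.card := by
  simp [Word.length, Word.restrict]

theorem Word.restrict_univ (w : Word s n) (h : (Finset.univ : Finset (Fin w.length)).Nonempty) :
    w.restrict Finset.univ h = w := by
  refine Subtype.ext ?_
  simp only [Word.restrict]
  rw [Fin.sort_univ]
  exact List.map_get_finRange _

theorem Word.univ_nonempty (w : Word s n) : (Finset.univ : Finset (Fin w.length)).Nonempty :=
  ⟨⟨0, List.length_pos_of_ne_nil w.2.1⟩, Finset.mem_univ _⟩

/-- The coefficients of `f` at the restrictions of `w`, as a function of subsets. -/
noncomputable def wordFun (f : Word s n → R) (w : Word s n) (V : Finset (Fin w.length)) : R :=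
  open Classical in if hV : V.Nonempty then f (w.restrict V hV) else 0

theorem wordFun_of_nonempty (f : Word s n → R) (w : Word s n) {V : Finset (Fin w.length)}
    (hV : V.Nonempty) : wordFun f w V = f (w.restrict V hV) := dif_pos hV

theorem coeffProd_eq_blockProd (f : Word s n → R) (w : Word s n)
    (π : Finpartition (Finset.univ : Finset (Fin w.length))) :
    coeffProd f w π = blockProd (wordFun f w) π := by
  refine Eq.trans ?_ (Finset.prod_coe_sort π.parts (wordFun f w))
  exact Finset.prod_congr rfl fun (V : {V // V ∈ π.parts}) _ =>
    (wordFun_of_nonempty f w (π.nonempty_of_mem_parts V.2)).symm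

theorem kreweras_eq_kr {m : ℕ} (π : Finpartition (Finset.univ : Finset (Fin m))) :
    kreweras π = kr π := by
  refine finpartition_ext fun x y => ?_
  obtain ⟨W, hW, hx⟩ := (kreweras π).exists_mem (Finset.mem_univ x)
  rw [sameBlock_iff_mem hW hx, kreweras_rel π hW hx, sameBlock_kr]
  constructor
  · exact fun h => ⟨Finset.mem_univ _, Finset.mem_univ _,
      fun a b ⟨U, hU, ha, hb⟩ => h U hU a ha b hb⟩
  · exact fun h U hU a ha b hb => h.2.2 a b ⟨U, hU, ha, hb⟩

theorem boxConv_eq_setBox (f g : Word s n → R) (w : Word s n) :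
    boxConv f g w = setBox (wordFun f w) (wordFun g w) Finset.univ := by
  refine Finset.sum_congr rfl fun π _ => ?_
  rw [coeffProd_eq_blockProd, coeffProd_eq_blockProd, kreweras_eq_kr]

/-- Restriction of words is transitive: restricting `w|V` to `Z` gives `w` restricted to the image
of `Z` under the increasing enumeration of `V`. -/
theorem wordFun_restrict (f : Word s n → R) (w : Word s n) {V : Finset (Fin w.length)}
    (hV : V.Nonempty) (Z : Finset (Fin (w.restrict V hV).length)) :
    wordFun f (w.restrict V hV) Z =
      wordFun f w (Z.map (V.orderEmbOfFin (w.length_restrict V hV).symm).toEmbedding) := by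
  rcases Z.eq_empty_or_nonempty with rfl | hZ
  · simp [wordFun]
  · rw [wordFun_of_nonempty f _ hZ, wordFun_of_nonempty f _ (hZ.map)]
    congr 1
    refine Subtype.ext ?_
    have h : (Z.map (V.orderEmbOfFin (w.length_restrict V hV).symm).toEmbedding).sort (· ≤ ·) =
        (Z.sort (· ≤ ·)).map (V.orderEmbOfFin (w.length_restrict V hV).symm) := by
      refine (Finset.map_sort _ _ _ _ ?_).symm
      intro a _ b _
      exact (OrderEmbedding.le_iff_le _).symm
    change (Z.sort (· ≤ ·)).map _ = List.map _ ((Z.map _).sort (· ≤ ·))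
    rw [h, List.map_map]
    refine List.map_congr_left fun i _ => ?_
    refine (List.getElem_map (l := V.sort (· ≤ ·)) w.1.get).trans ?_
    exact congrArg w.1.get (Finset.orderEmbOfFin_apply V _ i).symm

theorem wordFun_boxConv (f g : Word s n → R) (w : Word s n) {V : Finset (Fin w.length)}
    (hV : V.Nonempty) :
    wordFun (boxConv f g) w V = setBox (wordFun f w) (wordFun g w) V := by
  rw [wordFun_of_nonempty _ w hV, boxConv_eq_setBox]
  have h := setBox_map (V.orderEmbOfFin (w.length_restrict V hV).symm) (wordFun f w)
    (wordFun g w) Finset.univ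
  rw [Finset.map_orderEmbOfFin_univ] at h
  rw [h]
  congr 1 <;> exact funext fun Z => wordFun_restrict _ w hV Z

theorem boxConv_assoc (f g h : Word s n → R) :
    boxConv (boxConv f g) h = boxConv f (boxConv g h) := by
  funext w
  rw [boxConv_eq_setBox, boxConv_eq_setBox,
    setBox_congr (fun U hU => wordFun_boxConv f g w hU) (fun U _ => rfl), setBox_assoc,
    setBox_congr (fun U _ => rfl) (fun U hU => (wordFun_boxConv g h w hU).symm)]

/-- The unit `∑ᵢ zᵢ` of the boxed convolution. -/
def wordDelta : Word s n → R := fun w => if w.length = 1 then 1 else 0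

theorem wordFun_wordDelta (w : Word s n) {V : Finset (Fin w.length)} (hV : V.Nonempty) :
    wordFun wordDelta w V = (setDelta V : R) := by
  rw [wordFun_of_nonempty _ w hV, wordDelta, setDelta, Word.length_restrict]

theorem wordFun_univ (f : Word s n → R) (w : Word s n) : wordFun f w Finset.univ = f w := by
  rw [wordFun_of_nonempty _ w w.univ_nonempty, w.restrict_univ]

theorem wordDelta_boxConv (f : Word s n → R) : boxConv wordDelta f = f := by
  funext w
  rw [boxConv_eq_setBox, setBox_congr (fun U hU => wordFun_wordDelta w hU) (fun U _ => rfl),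
    setDelta_setBox _ w.univ_nonempty, wordFun_univ]

/-- The equation at `w` is linear in `h w` with unit coefficient, and all other terms involve `h` at
strictly shorter words only. It is therefore solved recursively. -/
theorem exists_boxConv_eq_wordDelta (f : Word s n → R)
    (hf : ∀ w : Word s n, w.length = 1 → IsUnit (f w)) : ∃ h, boxConv h f = wordDelta := by
  classical
  have hu : ∀ w : Word s n, IsUnit (blockProd (wordFun f w) (⊥ : Finpartition Finset.univ)) := by
    intro w
    rw [blockProd_bot]
    refine IsUnit.prod_univ_iff.2 fun i => ?_
    rw [wordFun_of_nonempty f w (Finset.singleton_nonempty i)]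
    exact hf _ (by rw [Word.length_restrict, Finset.card_singleton])
  choose u hu using hu
  let rest (h : Word s n → R) (w : Word s n) : R :=
    ∑ π : Finpartition (Finset.univ : Finset (Fin w.length)) with IsNonCrossing π.parts ∧ π ≠ ⊤,
      blockProd (wordFun h w) π * blockProd (wordFun f w) (kr π)
  -- The term of `⊤` is split off. Its complement is `⊥`, whose contribution is the product `u w` of
  -- the letter coefficients of `f`.
  have hbox : ∀ h w, boxConv h f w = h w * u w + rest h w := by
    intro h w
    rw [boxConv_eq_setBox, setBox, ← Finset.add_sum_erase _ _ (a := ⊤) (by simpa using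
      isNonCrossing_top), blockProd_top _ w.univ_nonempty, wordFun_univ, kr_top, hu]
    congr 1
    refine Finset.sum_congr ?_ fun _ _ => rfl
    ext π
    simp [and_comm]
  obtain ⟨h, hh⟩ := exists_fixedPoint_of_lt Word.length
    (fun h w => (wordDelta w - rest h w) * ↑(u w)⁻¹) (by
      intro w h h' H
      refine congrArg (fun r : R => (wordDelta w - r) * ↑(u w)⁻¹) ?_
      refine Finset.sum_congr rfl fun π hπ => congrArg (· * _) ?_
      refine Finset.prod_congr rfl fun V hV => ?_
      have hV' := π.nonempty_of_mem_parts hV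
      rw [wordFun_of_nonempty _ w hV', wordFun_of_nonempty _ w hV']
      refine H _ ?_
      rw [Word.length_restrict]
      have hne : V ≠ Finset.univ := by
        rintro rfl
        refine (Finset.mem_filter.1 hπ).2.2 (finpartition_ext fun x y => ?_)
        rw [sameBlock_top]
        exact ⟨fun h => ⟨h.mem_left, h.mem_right⟩, fun h => ⟨_, hV, h.1, h.2⟩⟩
      simpa using Finset.card_lt_card (Finset.ssubset_univ_iff.2 hne))
  refine ⟨h, funext fun w => ?_⟩
  have hw : (wordDelta w - rest h w) * ↑(u w)⁻¹ = h w := congrFun hh w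
  rw [hbox, ← hw, Units.inv_mul_cancel_right, sub_add_cancel]

noncomputable instance : Group (GSet s n R) :=
  letI : One (GSet s n R) :=
    ⟨⟨wordDelta, fun w hw => by rw [wordDelta, if_pos hw]; exact isUnit_one⟩⟩
  have hinv : ∀ f : GSet s n R, ∃ h : GSet s n R, h * f = 1 := fun f => by
    obtain ⟨h, hh⟩ := exists_boxConv_eq_wordDelta f.1 f.2
    refine ⟨⟨h, fun w hw => ?_⟩, Subtype.ext hh⟩
    have := congrFun hh w
    rw [boxConv_of_length_eq_one _ _ w hw, wordDelta, if_pos hw] at this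
    exact IsUnit.of_mul_eq_one _ this
  letI : Inv (GSet s n R) := ⟨fun f => (hinv f).choose⟩
  Group.ofLeftAxioms (fun f g h => Subtype.ext (boxConv_assoc f.1 g.1 h.1))
    (fun f => Subtype.ext (wordDelta_boxConv f.1)) (fun f => (hinv f).choose_spec)

noncomputable instance : Group (GPlusSet s n R) :=
  letI : One (GPlusSet s n R) := ⟨⟨wordDelta, fun w hw => by rw [wordDelta, if_pos hw]⟩⟩
  have hinv : ∀ f : GPlusSet s n R, ∃ h : GPlusSet s n R, h * f = 1 := fun f => by
    obtain ⟨h, hh⟩ := exists_boxConv_eq_wordDelta f.1 fun w hw => by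
      rw [f.2 w hw]; exact isUnit_one
    refine ⟨⟨h, fun w hw => ?_⟩, Subtype.ext hh⟩
    have := congrFun hh w
    rwa [boxConv_of_length_eq_one _ _ w hw, wordDelta, if_pos hw, f.2 w hw, mul_one] at this
  letI : Inv (GPlusSet s n R) := ⟨fun f => (hinv f).choose⟩
  Group.ofLeftAxioms (fun f g h => Subtype.ext (boxConv_assoc f.1 g.1 h.1))
    (fun f => Subtype.ext (wordDelta_boxConv f.1)) (fun f => (hinv f).choose_spec)

end WordBox

/-! ### From representable group-valued functors to Hopf algebras -/

section Yoneda

variable {k : Type u} [CommRing k]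

/-- The operation of `F` makes all `F(R)` groups. -/
structure IsGroupValued (F : CommAlgCat.{u} k ⥤ MagmaCat.{u}) : Prop where
  assoc : ∀ (R : CommAlgCat.{u} k) (x y z : F.obj R), x * y * z = x * (y * z)
  exists_one : ∀ R : CommAlgCat.{u} k, ∃ e : F.obj R, (∀ x, e * x = x ∧ x * e = x) ∧
    ∀ x, ∃ y, y * x = e ∧ x * y = e

namespace IsGroupValued

variable {F : CommAlgCat.{u} k ⥤ MagmaCat.{u}} (hF : IsGroupValued F)

/-- The neutral element of `F(R)`. -/
noncomputable def one (R : CommAlgCat.{u} k) : F.obj R := (hF.exists_one R).choose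

theorem one_mul (R : CommAlgCat.{u} k) (x : F.obj R) : hF.one R * x = x :=
  ((hF.exists_one R).choose_spec.1 x).1

theorem mul_one (R : CommAlgCat.{u} k) (x : F.obj R) : x * hF.one R = x :=
  ((hF.exists_one R).choose_spec.1 x).2

theorem exists_inv (R : CommAlgCat.{u} k) (x : F.obj R) :
    ∃ y, y * x = hF.one R ∧ x * y = hF.one R :=
  (hF.exists_one R).choose_spec.2 x

/-- The transition maps are only known to be multiplicative, but the image of the unit is
idempotent, hence trivial in a group. -/
theorem map_one {R S : CommAlgCat.{u} k} (f : R ⟶ S) : F.map f (hF.one R) = hF.one S := by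
  have h : F.map f (hF.one R) * F.map f (hF.one R) = F.map f (hF.one R) := by
    rw [← map_mul, hF.one_mul]
  obtain ⟨y, hy, -⟩ := hF.exists_inv S (F.map f (hF.one R))
  rw [← hF.one_mul S (F.map f (hF.one R)), ← hy, hF.assoc, h]

end IsGroupValued

/-- `F`, as a set-valued functor, is represented by `A` with universal element `a`. -/
def IsUniversal (F : CommAlgCat.{u} k ⥤ MagmaCat.{u}) (A : Type u) [CommRing A] [Algebra k A]
    (a : F.obj (CommAlgCat.of k A)) : Prop :=
  ∀ (R : Type u) [CommRing R] [Algebra k R],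
    Function.Bijective fun φ : A →ₐ[k] R => F.map (CommAlgCat.ofHom φ) a

namespace IsUniversal

variable {F : CommAlgCat.{u} k ⥤ MagmaCat.{u}} {A : Type u} [CommRing A] [Algebra k A]
  {a : F.obj (CommAlgCat.of k A)} (ha : IsUniversal F A a)

section

variable {R S : Type u} [CommRing R] [Algebra k R] [CommRing S] [Algebra k S]

theorem map_comp (a : F.obj (CommAlgCat.of k A)) (φ : A →ₐ[k] R) (ψ : R →ₐ[k] S) :
    F.map (CommAlgCat.ofHom (ψ.comp φ)) a =
      F.map (CommAlgCat.ofHom ψ) (F.map (CommAlgCat.ofHom φ) a) := by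
  rw [CommAlgCat.ofHom_comp, F.map_comp]
  rfl

include ha in
theorem hom_ext {φ ψ : A →ₐ[k] R}
    (h : F.map (CommAlgCat.ofHom φ) a = F.map (CommAlgCat.ofHom ψ) a) : φ = ψ :=
  (ha R).1 h

/-- The homomorphism classifying an element of `F(R)`. -/
noncomputable def lift (x : F.obj (CommAlgCat.of k R)) : A →ₐ[k] R := ((ha R).2 x).choose

theorem map_lift (x : F.obj (CommAlgCat.of k R)) : F.map (CommAlgCat.ofHom (ha.lift x)) a = x :=
  ((ha R).2 x).choose_spec

/-- The comultiplication induced by the operation of `F`. -/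
noncomputable def comul : A →ₐ[k] A ⊗[k] A :=
  ha.lift (F.map (CommAlgCat.ofHom Algebra.TensorProduct.includeLeft) a *
    F.map (CommAlgCat.ofHom Algebra.TensorProduct.includeRight) a :
      F.obj (CommAlgCat.of k (A ⊗[k] A)))

/-- The convolution product of two homomorphisms. -/
noncomputable def conv (φ ψ : A →ₐ[k] R) : A →ₐ[k] R :=
  (Algebra.TensorProduct.lift φ ψ fun _ _ => Commute.all _ _).comp ha.comul

theorem map_conv (φ ψ : A →ₐ[k] R) : F.map (CommAlgCat.ofHom (ha.conv φ ψ)) a =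
    (F.map (CommAlgCat.ofHom φ) a * F.map (CommAlgCat.ofHom ψ) a : F.obj (CommAlgCat.of k R)) := by
  have h1 : (Algebra.TensorProduct.lift φ ψ fun _ _ => Commute.all _ _).comp
      Algebra.TensorProduct.includeLeft = φ := by ext; simp
  have h2 : (Algebra.TensorProduct.lift φ ψ fun _ _ => Commute.all _ _).comp
      Algebra.TensorProduct.includeRight = ψ := by ext; simp
  rw [conv, map_comp, comul, map_lift, map_mul, ← map_comp, ← map_comp, h1, h2]

variable (hF : IsGroupValued F)

/-- The counit induced by the neutral element of `F`. -/
noncomputable def counit : A →ₐ[k] k := ha.lift (hF.one (CommAlgCat.of k k))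

/-- The antipode induced by the inversion of `F`. -/
noncomputable def antipode : A →ₐ[k] A := ha.lift (hF.exists_inv (CommAlgCat.of k A) a).choose

theorem map_counit (χ : k →ₐ[k] R) : F.map (CommAlgCat.ofHom (χ.comp (ha.counit hF))) a =
    hF.one (CommAlgCat.of k R) := by
  rw [map_comp, counit, map_lift, hF.map_one]

include hF in
theorem conv_assoc (φ ψ χ : A →ₐ[k] R) :
    ha.conv (ha.conv φ ψ) χ = ha.conv φ (ha.conv ψ χ) := by
  refine ha.hom_ext ?_
  simp only [map_conv]
  exact hF.assoc _ _ _ _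

theorem counit_conv (φ : A →ₐ[k] R) (χ : k →ₐ[k] R) :
    ha.conv (χ.comp (ha.counit hF)) φ = φ := by
  refine ha.hom_ext ?_
  rw [map_conv, map_counit, hF.one_mul]

theorem conv_counit (φ : A →ₐ[k] R) (χ : k →ₐ[k] R) :
    ha.conv φ (χ.comp (ha.counit hF)) = φ := by
  refine ha.hom_ext ?_
  rw [map_conv, map_counit, hF.mul_one]

end

theorem map_id (a : F.obj (CommAlgCat.of k A)) :
    F.map (CommAlgCat.ofHom (AlgHom.id k A)) a = a := by
  rw [CommAlgCat.ofHom_id, F.map_id]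
  rfl

variable (hF : IsGroupValued F)

/-- The bialgebra structure on the algebra representing a group-valued functor. -/
noncomputable abbrev bialgebra : Bialgebra k A :=
  Bialgebra.ofAlgHom ha.comul (ha.counit hF)
    (by
      -- Both iterated comultiplications are rewritten as convolutions of the three inclusions `A →
      -- A ⊗ A ⊗ A`, so coassociativity becomes associativity of `conv`.
      have h1 : (Algebra.TensorProduct.assoc k k k A A A).toAlgHom.comp
          (Algebra.TensorProduct.map ha.comul (.id k A)) =
          Algebra.TensorProduct.lift
            (ha.conv Algebra.TensorProduct.includeLeft
              (Algebra.TensorProduct.includeRight.comp Algebra.TensorProduct.includeLeft))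
            (Algebra.TensorProduct.includeRight.comp Algebra.TensorProduct.includeRight)
            fun _ _ => Commute.all _ _ := by
        have h : (Algebra.TensorProduct.assoc k k k A A A).toAlgHom.comp
            Algebra.TensorProduct.includeLeft = Algebra.TensorProduct.lift
            Algebra.TensorProduct.includeLeft (Algebra.TensorProduct.includeRight.comp
              Algebra.TensorProduct.includeLeft) fun _ _ => Commute.all _ _ := by
          ext <;> simp [Algebra.TensorProduct.one_def]
        refine Algebra.TensorProduct.ext (AlgHom.ext fun x => ?_) (AlgHom.ext fun x => ?_)
        · simpa [conv] using DFunLike.congr_fun h (ha.comul x)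
        · simp [Algebra.TensorProduct.one_def]
      have h2 : Algebra.TensorProduct.map (.id k A) ha.comul =
          Algebra.TensorProduct.lift Algebra.TensorProduct.includeLeft
            (ha.conv (Algebra.TensorProduct.includeRight.comp Algebra.TensorProduct.includeLeft)
              (Algebra.TensorProduct.includeRight.comp Algebra.TensorProduct.includeRight))
            fun _ _ => Commute.all _ _ := by
        have h : (Algebra.TensorProduct.includeRight : A ⊗[k] A →ₐ[k] A ⊗[k] (A ⊗[k] A)) =
            Algebra.TensorProduct.lift
            (Algebra.TensorProduct.includeRight.comp Algebra.TensorProduct.includeLeft)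
            (Algebra.TensorProduct.includeRight.comp Algebra.TensorProduct.includeRight)
            fun _ _ => Commute.all _ _ := by
          ext <;> simp
        refine Algebra.TensorProduct.ext (AlgHom.ext fun x => ?_) (AlgHom.ext fun x => ?_)
        · simp
        · simpa [conv] using DFunLike.congr_fun h (ha.comul x)
      rw [← AlgHom.comp_assoc, h1, h2]
      exact ha.conv_assoc hF _ _ _)
    (by
      have h : Algebra.TensorProduct.map (ha.counit hF) (.id k A) =
          Algebra.TensorProduct.lift
            ((Algebra.TensorProduct.includeLeft : k →ₐ[k] k ⊗[k] A).comp (ha.counit hF))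
            Algebra.TensorProduct.includeRight fun _ _ => Commute.all _ _ := by
        ext <;> simp
      rw [h]
      refine (ha.counit_conv hF _ _).trans ?_
      ext x
      simp)
    (by
      have h : Algebra.TensorProduct.map (.id k A) (ha.counit hF) =
          Algebra.TensorProduct.lift Algebra.TensorProduct.includeLeft
            ((Algebra.TensorProduct.includeRight : k →ₐ[k] A ⊗[k] k).comp (ha.counit hF))
            fun _ _ => Commute.all _ _ := by
        ext <;> simp
      rw [h]
      refine (ha.conv_counit hF _ _).trans ?_
      ext x
      simp)

/-- The Hopf algebra structure on the algebra representing a group-valued functor. -/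
noncomputable abbrev hopfAlgebra : HopfAlgebra k A :=
  letI := ha.bialgebra hF
  HopfAlgebra.ofAlgHom (ha.antipode hF)
    (by
      refine ha.hom_ext ?_
      refine (ha.map_conv (ha.antipode hF) (.id k A)).trans ?_
      refine Eq.trans ?_ (ha.map_counit hF (Algebra.ofId k A)).symm
      rw [antipode, map_lift, map_id]
      exact (hF.exists_inv (CommAlgCat.of k A) a).choose_spec.1)
    (by
      refine ha.hom_ext ?_
      refine (ha.map_conv (.id k A) (ha.antipode hF)).trans ?_
      refine Eq.trans ?_ (ha.map_counit hF (Algebra.ofId k A)).symm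
      rw [antipode, map_lift, map_id]
      exact (hF.exists_inv (CommAlgCat.of k A) a).choose_spec.2)

theorem represents : @Represents k _ F A _ (ha.hopfAlgebra hF) a :=
  letI := ha.hopfAlgebra hF
  { bijective := ha
    map_conv := fun R _ _ φ ψ => by
      refine Eq.trans ?_ (ha.map_conv φ ψ)
      have h : (WithConv.toConv φ * WithConv.toConv ψ).ofConv = ha.conv φ ψ :=
        AlgHom.ext fun x => AlgHom.convMul_apply (WithConv.toConv φ) (WithConv.toConv ψ) x
      rw [h] }

theorem map_comul : F.map (CommAlgCat.ofHom ha.comul) a =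
    (F.map (CommAlgCat.ofHom Algebra.TensorProduct.includeLeft) a *
      F.map (CommAlgCat.ofHom Algebra.TensorProduct.includeRight) a :
        F.obj (CommAlgCat.of k (A ⊗[k] A))) := ha.map_lift _

end IsUniversal

end Yoneda

/-! ### Invariant lines in comodules over a weighted Hopf algebra -/

section ComoduleFixed

variable {k : Type u} [Field k] {A : Type u} [CommRing A] [HopfAlgebra k A]
  {V : Type v} [AddCommGroup V] [Module k V]

/-- The endomorphism of `V` induced by a linear functional on the co-ordinate algebra. -/
noncomputable def Comodule.act (ρ : Comodule k A V) (l : A →ₗ[k] k) : V →ₗ[k] V :=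
  (TensorProduct.rid k V).toLinearMap ∘ₗ l.lTensor V ∘ₗ ρ.coact

/-- Left contraction of the comultiplication with a linear functional. -/
noncomputable def contract (l : A →ₗ[k] k) : A →ₗ[k] A :=
  (TensorProduct.rid k A).toLinearMap ∘ₗ l.lTensor A ∘ₗ Coalgebra.comul

/-- This is coassociativity with `l` applied to the last tensor factor. It expresses the coaction on
a coefficient vector of `x` through the coaction on `x` and the comultiplication. -/
theorem Comodule.coact_act (ρ : Comodule k A V) (l : A →ₗ[k] k) (x : V) :
    ρ.coact (ρ.act l x) = (contract l).lTensor V (ρ.coact x) := by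
  have h1 : ρ.coact ∘ₗ (TensorProduct.rid k V).toLinearMap ∘ₗ l.lTensor V =
      (TensorProduct.rid k (V ⊗[k] A)).toLinearMap ∘ₗ l.lTensor (V ⊗[k] A) ∘ₗ
        ρ.coact.rTensor A := by
    ext v a
    simp
  have h2 : (TensorProduct.rid k (V ⊗[k] A)).toLinearMap ∘ₗ l.lTensor (V ⊗[k] A) =
      ((TensorProduct.rid k A).toLinearMap ∘ₗ l.lTensor A).lTensor V ∘ₗ
        (TensorProduct.assoc k V A A).toLinearMap := by
    ext v a b
    simp
  have h3 := LinearMap.congr_fun ρ.coassoc x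
  have h4 := LinearMap.congr_fun h1 (ρ.coact x)
  have h5 := LinearMap.congr_fun h2 (ρ.coact.rTensor A (ρ.coact x))
  simp only [LinearMap.comp_apply] at h3 h4 h5
  rw [Comodule.act, LinearMap.comp_apply, LinearMap.comp_apply, h4, h5, h3, contract,
    ← LinearMap.comp_assoc]
  exact (LinearMap.lTensor_comp_apply V _ _ _).symm

theorem Comodule.coact_eq_zero (ρ : Comodule k A V) {x : V} (h : ρ.coact x = 0) : x = 0 := by
  have := LinearMap.congr_fun ρ.counit x
  simpa [h] using this.symm

theorem Comodule.act_eq (ρ : Comodule k A V) {ι : Type*} [DecidableEq ι] (b : Module.Basis ι k A)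
    (i : ι) (x : V) :
    ρ.act (b.coord i) x = TensorProduct.equivFinsuppOfBasisRight b (ρ.coact x) i :=
  (TensorProduct.equivFinsuppOfBasisRight_apply b (ρ.coact x) i).symm

theorem Comodule.exists_coact_eq_sum (ρ : Comodule k A V) {ι : Type*} (b : Module.Basis ι k A)
    (x : V) : ∃ S : Finset ι, (∀ i, i ∈ S ↔ ρ.act (b.coord i) x ≠ 0) ∧
      ρ.coact x = ∑ i ∈ S, ρ.act (b.coord i) x ⊗ₜ[k] b i := by
  classical
  refine ⟨(TensorProduct.equivFinsuppOfBasisRight b (ρ.coact x)).support, fun i => ?_, ?_⟩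
  · rw [Finsupp.mem_support_iff, ρ.act_eq]
  · refine ((TensorProduct.equivFinsuppOfBasisRight b).symm_apply_apply (ρ.coact x)).symm.trans ?_
    rw [TensorProduct.equivFinsuppOfBasisRight_symm_apply]
    exact Finset.sum_congr rfl fun i _ => by rw [ρ.act_eq]

/-- If the comultiplication is compatible with a weight on a basis of the co-ordinate algebra, and
basis elements of weight zero are group-like, then every non-zero comodule contains a non-zero
vector on which the group acts through a basis element of weight zero. -/
theorem Comodule.exists_coact_eq_tmul {ι : Type*} (b : Module.Basis ι k A) (wt : ι → ℕ)
    (hcomul : ∀ i, Coalgebra.comul (R := k) (b i) ∈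
      Submodule.span k {t | ∃ p q, wt p + wt q ≤ wt i ∧ t = b p ⊗ₜ[k] b q})
    (hzero : ∀ i, wt i = 0 → Coalgebra.comul (R := k) (b i) = b i ⊗ₜ[k] b i)
    [Nontrivial V] (ρ : Comodule k A V) :
    ∃ x : V, x ≠ 0 ∧ ∃ i, wt i = 0 ∧ ρ.coact x = x ⊗ₜ[k] b i := by
  have hne : ∀ x : V, x ≠ 0 → ∃ i, ρ.act (b.coord i) x ≠ 0 := by
    intro x hx
    obtain ⟨S, hS, h⟩ := ρ.exists_coact_eq_sum b x
    by_contra! h'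
    refine hx (ρ.coact_eq_zero ?_)
    rw [h]
    exact Finset.sum_eq_zero fun i _ => by rw [h' i, TensorProduct.zero_tmul]
  -- Take for `u` the coefficient in `ρ(v)` of a basis element `b i` of maximal weight.
  have hu : ∃ u : V, u ≠ 0 ∧ ∀ p, wt p ≠ 0 → ρ.act (b.coord p) u = 0 := by
    obtain ⟨v, hv⟩ := exists_ne (0 : V)
    obtain ⟨S, hS, h⟩ := ρ.exists_coact_eq_sum b v
    obtain ⟨j, hj⟩ := hne v hv
    obtain ⟨i, hi, himax⟩ := S.exists_max_image wt ⟨j, (hS j).2 hj⟩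
    refine ⟨ρ.act (b.coord i) v, (hS i).1 hi, fun p hp => ?_⟩
    -- This is the coefficient of `b p ⊗ b i` in the comultiplication of `b j`. It vanishes because
    -- `wt p + wt i > wt j`.
    have hT : ∀ j, wt j ≤ wt i → b.coord p (contract (b.coord i) (b j)) = 0 := by
      intro j hj
      have : ∀ t ∈ Submodule.span k {t | ∃ p q, wt p + wt q ≤ wt j ∧ t = b p ⊗ₜ[k] b q},
          b.coord p ((TensorProduct.rid k A) ((b.coord i).lTensor A t)) = 0 := by
        intro t ht
        induction ht using Submodule.span_induction with
        | mem t ht =>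
          obtain ⟨p', q, hpq, rfl⟩ := ht
          simp only [LinearMap.lTensor_tmul, TensorProduct.rid_tmul, map_smul,
            Module.Basis.coord_apply,
            Module.Basis.repr_self, smul_eq_mul]
          by_cases hq : q = i
          · subst hq
            have : p' ≠ p := by rintro rfl; omega
            rw [Finsupp.single_eq_of_ne' this, mul_zero]
          · rw [Finsupp.single_eq_of_ne' hq, zero_mul]
        | zero => simp
        | add s t _ _ hs ht => rw [map_add, map_add, map_add, hs, ht, add_zero]
        | smul c t _ ht => rw [map_smul, map_smul, map_smul, ht, smul_zero]
      exact this _ (hcomul j)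
    rw [Comodule.act, LinearMap.comp_apply, LinearMap.comp_apply, ρ.coact_act, h, map_sum, map_sum,
      map_sum]
    refine Finset.sum_eq_zero fun j hj => ?_
    rw [LinearMap.lTensor_tmul, LinearMap.lTensor_tmul, hT j (himax j hj)]
    simp
  obtain ⟨u, hu, hu0⟩ := hu
  obtain ⟨S, hS, h⟩ := ρ.exists_coact_eq_sum b u
  obtain ⟨p, hp⟩ := hne u hu
  -- The coaction on `u` now involves group-like basis elements only, so each of its coefficient
  -- vectors is an eigenvector.
  have hwt : ∀ j ∈ S, wt j = 0 := fun j hj => by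
    by_contra hj'
    exact (hS j).1 hj (hu0 j hj')
  refine ⟨ρ.act (b.coord p) u, hp, p, hwt p ((hS p).2 hp), ?_⟩
  rw [ρ.coact_act, h, map_sum, Finset.sum_eq_single_of_mem p ((hS p).2 hp)]
  · simp [contract, hzero p (hwt p ((hS p).2 hp))]
  · intro j hj hjp
    simp [contract, hzero j (hwt j hj), Finsupp.single_eq_of_ne' hjp]

theorem IsUniversal.exists_coact_eq_tmul {F : CommAlgCat.{u} k ⥤ MagmaCat.{u}} {A : Type u}
    [CommRing A] [Algebra k A] {a : F.obj (CommAlgCat.of k A)} (ha : IsUniversal F A a)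
    (hF : IsGroupValued F) {ι : Type*} (b : Module.Basis ι k A) (wt : ι → ℕ)
    (hcomul : ∀ i, ha.comul (b i) ∈
      Submodule.span k {t | ∃ p q, wt p + wt q ≤ wt i ∧ t = b p ⊗ₜ[k] b q})
    (hzero : ∀ i, wt i = 0 → ha.comul (b i) = b i ⊗ₜ[k] b i)
    [Nontrivial V] (ρ : @Comodule k _ A _ (ha.hopfAlgebra hF) V _ _) :
    ∃ x : V, x ≠ 0 ∧ ∃ i, wt i = 0 ∧
      @Comodule.coact k _ A _ (ha.hopfAlgebra hF) V _ _ ρ x = x ⊗ₜ[k] b i :=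
  let _ := ha.hopfAlgebra hF
  Comodule.exists_coact_eq_tmul b wt hcomul hzero ρ

end ComoduleFixed

/-! ### The common form of the two co-ordinate rings -/

section CoordRing

variable (k : Type u) [Field k] (s : ℕ) (n : ℕ∞) (N : Type) [AddCommGroup N]

/-- The letters, as words. -/
abbrev Letter : Type := {w : Word s n // w.length = 1}

/-- The words that are not letters. -/
abbrev LongWord : Type := {w : Word s n // w.length ≠ 1}

/-- The exponents of the monomials in the co-ordinate ring. -/
abbrev Exponent : Type := N × (LongWord s n →₀ ℕ)

/-- The tensor product of the group algebra `k[N]` with the polynomial ring in the variables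
`X_w`, `|w| ≠ 1`. -/
def CoordRing : Type u := AddMonoidAlgebra k (Exponent s n N)

noncomputable instance : CommRing (CoordRing k s n N) :=
  inferInstanceAs (CommRing (AddMonoidAlgebra k (Exponent s n N)))

noncomputable instance : Algebra k (CoordRing k s n N) :=
  inferInstanceAs (Algebra k (AddMonoidAlgebra k (Exponent s n N)))

theorem CoordRing.finiteType [AddMonoid.FG (Exponent s n N)] :
    Algebra.FiniteType k (CoordRing k s n N) :=
  AddMonoidAlgebra.finiteType_of_fg k (Exponent s n N)

namespace CoordRing

/-- The basis of monomials. -/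
noncomputable def basis : Module.Basis (Exponent s n N) k (CoordRing k s n N) :=
  AddMonoidAlgebra.basis (Exponent s n N) k

variable {k s n N}

theorem basis_zero : basis k s n N 0 = 1 := rfl

theorem basis_add (x y : Exponent s n N) :
    basis k s n N (x + y) = basis k s n N x * basis k s n N y := by
  refine Eq.symm ((AddMonoidAlgebra.single_mul_single (R := k) x y 1 1).trans ?_)
  rw [mul_one]
  rfl

theorem basis_sum {ι : Type*} (S : Finset ι) (x : ι → Exponent s n N) :
    basis k s n N (∑ i ∈ S, x i) = ∏ i ∈ S, basis k s n N (x i) := by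
  classical
  induction S using Finset.induction_on with
  | empty => simp [basis_zero]
  | insert i S hi ih => rw [Finset.sum_insert hi, Finset.prod_insert hi, basis_add, ih]

variable {B : Type*} [CommRing B] [Algebra k B]

/-- The homomorphism given by a character of `N` and the images of the variables. -/
noncomputable def lift (χ : Multiplicative N →* B) (g : LongWord s n → B) :
    CoordRing k s n N →ₐ[k] B :=
  AddMonoidAlgebra.lift k B (Exponent s n N)
    { toFun := fun x => χ (.ofAdd x.toAdd.1) * x.toAdd.2.prod fun w j => g w ^ j
      map_one' := by simp
      map_mul' := fun x y => by
        rw [toAdd_mul, Prod.fst_add, Prod.snd_add, ofAdd_add, map_mul,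
          Finsupp.prod_add_index' (fun _ => pow_zero _) (fun _ _ _ => pow_add _ _ _)]
        ring }

theorem lift_basis (χ : Multiplicative N →* B) (g : LongWord s n → B) (x : Exponent s n N) :
    lift χ g (basis k s n N x) = χ (.ofAdd x.1) * x.2.prod fun w j => g w ^ j :=
  (AddMonoidAlgebra.lift_single _ _ _).trans (one_smul _ _)

theorem algHom_ext {φ ψ : CoordRing k s n N →ₐ[k] B}
    (h : ∀ x, φ (basis k s n N x) = ψ (basis k s n N x)) : φ = ψ :=
  AlgHom.toLinearMap_injective ((basis k s n N).ext h)

/-- The character of `N` given by a homomorphism. -/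
noncomputable def character (φ : CoordRing k s n N →ₐ[k] B) : Multiplicative N →* B where
  toFun x := φ (basis k s n N (x.toAdd, 0))
  map_one' := by
    rw [toAdd_one, ← map_one φ]
    rfl
  map_mul' x y := by rw [← map_mul φ, ← basis_add, Prod.mk_add_mk, add_zero, toAdd_mul]

end CoordRing

theorem exponent_induction {s : ℕ} {n : ℕ∞} {N : Type} [AddCommGroup N] {p : Exponent s n N → Prop}
    (add : ∀ x y, p x → p y → p (x + y)) (left : ∀ x, p (x, 0))
    (right : ∀ w, p (0, Finsupp.single w 1)) (x : Exponent s n N) : p x := by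
  obtain ⟨x, y⟩ := x
  induction y using Finsupp.induction_linear generalizing x with
  | zero => exact left x
  | add y z hy hz => simpa using add _ _ (hy x) (hz 0)
  | single w j =>
    induction j with
    | zero => simpa using left x
    | succ j ih => simpa [Finsupp.single_add] using add _ _ ih (right w)

variable {k s n N} (e : Letter s n → N)

/-- The exponent of the variable `X_w`. -/
noncomputable def genExponent (w : Word s n) : Exponent s n N :=
  if h : w.length = 1 then (e ⟨w, h⟩, 0) else (0, Finsupp.single ⟨w, h⟩ 1)

variable (k) in
/-- The generic series `∑_w X_w z_w`. -/
noncomputable def genSeries (w : Word s n) : CoordRing k s n N :=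
  CoordRing.basis k s n N (genExponent e w)

theorem genSeries_letter (w : Letter s n) :
    genSeries k e w.1 = CoordRing.basis k s n N (e w, 0) := by
  rw [genSeries, genExponent, dif_pos w.2]

theorem genSeries_longWord (w : LongWord s n) :
    genSeries k e w.1 = CoordRing.basis k s n N (0, Finsupp.single w 1) := by
  rw [genSeries, genExponent, dif_neg w.2]

variable {e} (he : AddSubgroup.closure (Set.range e) = ⊤)

include he in
theorem character_ext {M : Type*} [Monoid M] {χ χ' : Multiplicative N →* M}
    (h : ∀ w, χ (.ofAdd (e w)) = χ' (.ofAdd (e w))) : χ = χ' := by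
  have : AddSubgroup.closure (Set.range e) ≤ Subgroup.toAddSubgroup' (χ.eqLocus χ') := by
    rw [AddSubgroup.closure_le]
    rintro _ ⟨w, rfl⟩
    exact h w
  rw [he] at this
  exact MonoidHom.ext fun x => this (AddSubgroup.mem_top x.toAdd)

include he in
-- Inverses of the letter variables need no separate check: two characters of the group `N` that
-- agree on generators agree everywhere.
theorem CoordRing.hom_ext {B : Type*} [CommRing B] [Algebra k B] {φ ψ : CoordRing k s n N →ₐ[k] B}
    (h : ∀ w, φ (genSeries k e w) = ψ (genSeries k e w)) : φ = ψ := by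
  refine CoordRing.algHom_ext fun x => ?_
  refine exponent_induction (p := fun x => φ (basis k s n N x) = ψ (basis k s n N x)) ?_ ?_ ?_ x
  · intro x y hx hy
    simp only [basis_add, map_mul, hx, hy]
  · intro x
    refine DFunLike.congr_fun (character_ext he (χ := character φ) (χ' := character ψ) ?_)
      (.ofAdd x)
    intro w
    have := h w.1
    rw [genSeries_letter] at this
    exact this
  · intro w
    rw [← genSeries_longWord e w]
    exact h w.1

/-! ### The weight on monomials -/

section Weight

/-- A rapidly growing sequence of weights. -/
def lengthWeight (m : ℕ) : ℕ := 2 ^ m * m.factorial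

theorem lengthWeight_pos (m : ℕ) : 0 < lengthWeight m := by
  unfold lengthWeight
  positivity

theorem lengthWeight_mono : Monotone lengthWeight := fun _ _ h =>
  Nat.mul_le_mul (Nat.pow_le_pow_right two_pos h) (Nat.factorial_le h)

/-- The weights are chosen for this identity. A partition of `m + 1` points other than `⊤` has at
most `m + 1` blocks, each of size at most `m`, so its monomial uses at most half of the weight
available in length `m + 1`. -/
theorem lengthWeight_succ (m : ℕ) :
    (m + 1) * lengthWeight m + (m + 1) * lengthWeight m = lengthWeight (m + 1) := by
  rw [lengthWeight, lengthWeight, pow_succ, Nat.factorial_succ]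
  ring

/-- The weight of a monomial. -/
noncomputable def weight : Exponent s n N →+ ℕ :=
  (Finsupp.weight fun w : LongWord s n => lengthWeight w.1.length).comp (AddMonoidHom.snd _ _)

theorem eq_zero_of_weight_eq_zero {x : Exponent s n N} (h : weight x = 0) : x.2 = 0 := by
  have := Finsupp.nonTorsionWeight_of ℕ (w := fun w : LongWord s n => lengthWeight w.1.length)
    fun w => (lengthWeight_pos _).ne'
  exact (Finsupp.weight_eq_zero_iff_eq_zero _).1 h

theorem weight_genExponent (w : Word s n) :
    weight (genExponent e w) = if w.length = 1 then 0 else lengthWeight w.length := by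
  unfold genExponent
  split_ifs with h
  · simp [weight]
  · simp [weight, Finsupp.weight_single]

variable {w : Word s n}

/-- The exponent of the monomial `X_{w,π}`. -/
noncomputable def blockExponent (e : Letter s n → N)
    (π : Finpartition (Finset.univ : Finset (Fin w.length))) : Exponent s n N :=
  ∑ V : {V // V ∈ π.parts}, genExponent e (w.restrict V.1 (π.nonempty_of_mem_parts V.2))

theorem coeffProd_genSeries (π : Finpartition (Finset.univ : Finset (Fin w.length))) :
    coeffProd (genSeries k e) w π = CoordRing.basis k s n N (blockExponent e π) :=
  (CoordRing.basis_sum _ _).symm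

theorem weight_blockExponent (π : Finpartition (Finset.univ : Finset (Fin w.length))) :
    weight (blockExponent e π) =
      ∑ V ∈ π.parts, if V.card = 1 then 0 else lengthWeight V.card := by
  refine (map_sum (weight (s := s) (n := n) (N := N)) _ _).trans
    (Eq.trans ?_ (Finset.sum_coe_sort π.parts _))
  refine Finset.sum_congr rfl fun (V : {V // V ∈ π.parts}) _ => ?_
  rw [weight_genExponent, Word.length_restrict]

theorem weight_blockExponent_bot :
    weight (blockExponent e (⊥ : Finpartition (Finset.univ : Finset (Fin w.length)))) = 0 := by
  rw [weight_blockExponent]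
  refine Finset.sum_eq_zero fun V hV => ?_
  obtain ⟨x, -, rfl⟩ := Finpartition.mem_bot_iff.1 hV
  simp

theorem weight_blockExponent_top :
    weight (blockExponent e (⊤ : Finpartition (Finset.univ : Finset (Fin w.length)))) ≤
      lengthWeight w.length := by
  rw [weight_blockExponent, parts_top_eq w.univ_nonempty, Finset.sum_singleton, Finset.card_univ,
    Fintype.card_fin]
  split_ifs <;> simp

theorem weight_blockExponent_le {π : Finpartition (Finset.univ : Finset (Fin w.length))}
    (hπ : π ≠ ⊤) {m : ℕ} (hm : w.length = m + 1) :
    weight (blockExponent e π) ≤ (m + 1) * lengthWeight m := by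
  rw [weight_blockExponent]
  refine (Finset.sum_le_card_nsmul _ _ (lengthWeight m) fun V hV => ?_).trans ?_
  · have hne : V ≠ Finset.univ := by
      rintro rfl
      refine hπ (finpartition_ext fun x y => ?_)
      rw [sameBlock_top]
      exact ⟨fun h => ⟨h.mem_left, h.mem_right⟩, fun h => ⟨_, hV, h.1, h.2⟩⟩
    have := Finset.card_lt_card (Finset.ssubset_univ_iff.2 hne)
    have : V.card < m + 1 := by simpa [hm] using this
    split_ifs
    · exact Nat.zero_le _
    · exact lengthWeight_mono (Nat.lt_succ_iff.1 this)
  · rw [smul_eq_mul]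
    refine Nat.mul_le_mul_right _ (π.card_parts_le_card.trans ?_)
    rw [Finset.card_univ, Fintype.card_fin, hm]

/-- If `π` is `⊤` or `⊥`, one factor consists of letters and weighs nothing. Otherwise neither `π`
nor its complement is `⊤`, and each takes at most half of the bound. The crude growth of the weights
makes the exact count `|π| + |K(π)| = |w| + 1` unnecessary. -/
theorem weight_add_weight_kreweras_le {π : Finpartition (Finset.univ : Finset (Fin w.length))}
    (hπ : IsNonCrossing π.parts) :
    weight (blockExponent e π) + weight (blockExponent e (kreweras π)) ≤ lengthWeight w.length := by
  rw [kreweras_eq_kr]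
  by_cases h1 : π = ⊤
  · rw [h1, kr_top, weight_blockExponent_bot, add_zero]
    exact weight_blockExponent_top
  by_cases h2 : π = ⊥
  · rw [h2, kr_bot, weight_blockExponent_bot, zero_add]
    exact weight_blockExponent_top
  have h3 : kr π ≠ ⊤ := fun h => h2 (kr_injective hπ isNonCrossing_bot (h.trans kr_bot.symm))
  obtain ⟨m, hm⟩ := Nat.exists_eq_succ_of_ne_zero (List.length_pos_of_ne_nil w.2.1).ne'
  calc _ ≤ _ := add_le_add (weight_blockExponent_le h1 hm) (weight_blockExponent_le h3 hm)
    _ = lengthWeight (m + 1) := lengthWeight_succ m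
    _ = _ := congrArg lengthWeight hm.symm

end Weight

/-! ### Compatibility of the comultiplication with the weight -/

section Comul

variable (Δ : CoordRing k s n N →ₐ[k] CoordRing k s n N ⊗[k] CoordRing k s n N)
  (hΔ : Δ ∘ genSeries k e =
    boxConv ((Algebra.TensorProduct.includeLeft :
        CoordRing k s n N →ₐ[k] CoordRing k s n N ⊗[k] CoordRing k s n N) ∘ genSeries k e)
      ((Algebra.TensorProduct.includeRight :
        CoordRing k s n N →ₐ[k] CoordRing k s n N ⊗[k] CoordRing k s n N) ∘ genSeries k e))

-- Weight zero leaves only letter variables and their inverses. Letters are group-like because the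
-- convolution is pointwise multiplication on them, and this extends to all of `N` because both
-- sides are characters.
include he hΔ in
theorem comul_basis_of_weight_eq_zero (x : Exponent s n N) (hx : weight x = 0) :
    Δ (CoordRing.basis k s n N x) = CoordRing.basis k s n N x ⊗ₜ CoordRing.basis k s n N x := by
  obtain ⟨x, y⟩ := x
  obtain rfl : y = 0 := eq_zero_of_weight_eq_zero hx
  refine DFunLike.congr_fun (character_ext he (χ := CoordRing.character Δ)
    (χ' := CoordRing.character Algebra.TensorProduct.includeLeft *
      CoordRing.character Algebra.TensorProduct.includeRight) fun w => ?_) (.ofAdd x) |>.trans ?_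
  · have := congrFun hΔ w.1
    rw [boxConv_of_length_eq_one _ _ _ w.2] at this
    simp only [Function.comp_apply, genSeries_letter] at this
    exact this
  · refine (Algebra.TensorProduct.tmul_mul_tmul _ _ _ _).trans ?_
    rw [mul_one, one_mul]
    rfl

-- The filtration property passes to products of monomials, so it reduces to the generators. For the
-- variable of a long word the summands of `Δ X_w` are `X_{w,π} ⊗ X_{w,K(π)}`, which
-- `weight_add_weight_kreweras_le` bounds.
include he hΔ in
theorem comul_basis_mem_span (x : Exponent s n N) :
    Δ (CoordRing.basis k s n N x) ∈ Submodule.span k {t | ∃ p q, weight p + weight q ≤ weight x ∧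
      t = CoordRing.basis k s n N p ⊗ₜ[k] CoordRing.basis k s n N q} := by
  induction x using exponent_induction with
  | add x y hx hy =>
    rw [CoordRing.basis_add, map_mul]
    have h := Submodule.mul_mem_mul hx hy
    rw [Submodule.span_mul_span] at h
    refine Submodule.span_mono ?_ h
    rintro _ ⟨_, ⟨p, q, h, rfl⟩, _, ⟨p', q', h', rfl⟩, rfl⟩
    refine ⟨p + p', q + q', ?_, ?_⟩
    · simp only [map_add]
      omega
    · rw [CoordRing.basis_add, CoordRing.basis_add]
      exact Algebra.TensorProduct.tmul_mul_tmul _ _ _ _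
  | left x =>
    have hx : weight ((x, 0) : Exponent s n N) = 0 := by simp [weight]
    rw [comul_basis_of_weight_eq_zero he Δ hΔ _ hx]
    exact Submodule.subset_span ⟨(x, 0), (x, 0), by rw [hx], rfl⟩
  | right w =>
    have hw : weight ((0, Finsupp.single w 1) : Exponent s n N) = lengthWeight w.1.length := by
      simp [weight, Finsupp.weight_single]
    rw [← genSeries_longWord e w, hw]
    have h := congrFun hΔ w.1
    rw [Function.comp_apply] at h
    rw [h]
    refine Submodule.sum_mem _ fun π hπ => ?_
    refine Submodule.subset_span ⟨blockExponent e π, blockExponent e (kreweras π),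
      weight_add_weight_kreweras_le (Finset.mem_filter.1 hπ).2, ?_⟩
    have h1 : ∀ (φ : CoordRing k s n N →ₐ[k] CoordRing k s n N ⊗[k] CoordRing k s n N)
        (π : Finpartition (Finset.univ : Finset (Fin w.1.length))),
        coeffProd (φ ∘ genSeries k e) w.1 π =
          φ (CoordRing.basis k s n N (blockExponent e π)) := fun φ π => by
      rw [← coeffProd_genSeries]
      exact (map_prod φ _ _).symm
    rw [h1, h1]
    refine (Algebra.TensorProduct.tmul_mul_tmul _ _ _ _).trans ?_
    rw [mul_one, one_mul]

end Comul

end CoordRing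

/-! ### Representability, finite generation and representations of the two functors -/

section Representability

variable (k : Type u) [Field k] (s : ℕ) (n : ℕ∞)

theorem isGroupValued_G : IsGroupValued (G k s n) where
  assoc R x y z := mul_assoc (G := GSet s n R) x y z
  exists_one R := ⟨(1 : GSet s n R),
    fun x => ⟨one_mul (M := GSet s n R) x, mul_one (M := GSet s n R) x⟩,
    fun x => ⟨(Inv.inv (α := GSet s n R) x), inv_mul_cancel (G := GSet s n R) x,
      mul_inv_cancel (G := GSet s n R) x⟩⟩

theorem isGroupValued_GPlus : IsGroupValued (GPlus k s n) where
  assoc R x y z := mul_assoc (G := GPlusSet s n R) x y z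
  exists_one R := ⟨(1 : GPlusSet s n R),
    fun x => ⟨one_mul (M := GPlusSet s n R) x, mul_one (M := GPlusSet s n R) x⟩,
    fun x => ⟨(Inv.inv (α := GPlusSet s n R) x), inv_mul_cancel (G := GPlusSet s n R) x,
      mul_inv_cancel (G := GPlusSet s n R) x⟩⟩

/-- The letters as exponents of invertible variables. -/
noncomputable def letterExponent (w : Letter s n) : Letter s n →₀ ℤ := Finsupp.single w 1

theorem closure_letterExponent : AddSubgroup.closure (Set.range (letterExponent s n)) = ⊤ := by
  refine eq_top_iff.2 fun x _ => ?_
  induction x using Finsupp.induction_linear with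
  | zero => exact zero_mem _
  | add x y hx hy => exact add_mem (hx trivial) (hy trivial)
  | single w j =>
    have h : Finsupp.single w j = j • letterExponent s n w := by simp [letterExponent]
    rw [h]
    exact zsmul_mem (AddSubgroup.subset_closure (Set.mem_range_self w)) j

/-- The exponents of the letters if the corresponding variables are set to one. -/
def trivialExponent (_ : Letter s n) : PUnit.{1} := 0

theorem closure_trivialExponent : AddSubgroup.closure (Set.range (trivialExponent s n)) = ⊤ :=
  Subsingleton.elim _ _

/-- The co-ordinate algebra of `(𝔊ˢ)ₙ`. -/
abbrev GRing : Type u := CoordRing k s n (Letter s n →₀ ℤ)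

/-- The co-ordinate algebra of `(𝔊ˢ₊)ₙ`. -/
abbrev GPlusRing : Type u := CoordRing k s n PUnit.{1}

theorem isUnit_genSeries (w : Word s n) (hw : w.length = 1) :
    IsUnit (genSeries k (letterExponent s n) w) := by
  rw [genSeries_letter (letterExponent s n) ⟨w, hw⟩]
  refine IsUnit.of_mul_eq_one (CoordRing.basis k s n _ (-letterExponent s n ⟨w, hw⟩, 0)) ?_
  rw [← CoordRing.basis_add, Prod.mk_add_mk, add_neg_cancel, add_zero]
  exact CoordRing.basis_zero

theorem genSeries_trivialExponent (w : Word s n) (hw : w.length = 1) :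
    genSeries k (trivialExponent s n) w = 1 :=
  (genSeries_letter (trivialExponent s n) ⟨w, hw⟩).trans CoordRing.basis_zero

/-- The universal element of `(𝔊ˢ)ₙ`. -/
noncomputable def GElt : (G k s n).obj (CommAlgCat.of k (GRing k s n)) :=
  (⟨genSeries k (letterExponent s n), isUnit_genSeries k s n⟩ : GSet s n (GRing k s n))

/-- The universal element of `(𝔊ˢ₊)ₙ`. -/
noncomputable def GPlusElt : (GPlus k s n).obj (CommAlgCat.of k (GPlusRing k s n)) :=
  (⟨genSeries k (trivialExponent s n), genSeries_trivialExponent k s n⟩ :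
    GPlusSet s n (GPlusRing k s n))

/-- The character of `Letter s n →₀ ℤ` with given values. -/
noncomputable def unitsCharacter {s : ℕ} {n : ℕ∞} {R : Type*} [CommRing R] (u : Letter s n → Rˣ) :
    Multiplicative (Letter s n →₀ ℤ) →* R :=
  (Units.coeHom R).comp
    { toFun := fun x => x.toAdd.prod fun w j => u w ^ j
      map_one' := by simp
      map_mul' := fun x y => by
        rw [toAdd_mul, Finsupp.prod_add_index' (fun _ => zpow_zero _) fun _ _ _ => zpow_add _ _ _] }

/-- Unit letter coefficients amount to a character of the free abelian group on the letters, and the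
remaining coefficients are arbitrary values of polynomial variables. -/
theorem isUniversal_G : IsUniversal (G k s n) (GRing k s n) (GElt k s n) := by
  intro R _ _
  constructor
  · intro φ ψ h
    exact CoordRing.hom_ext (closure_letterExponent s n) (congrFun (congrArg Subtype.val h))
  · rintro ⟨f, hf⟩
    choose u hu using fun w : Letter s n => hf w.1 w.2
    refine ⟨CoordRing.lift (unitsCharacter u) fun w => f w.1, Subtype.ext (funext fun w => ?_)⟩
    change CoordRing.lift _ _ (genSeries k (letterExponent s n) w) = f w
    by_cases hw : w.length = 1
    · rw [genSeries_letter (letterExponent s n) ⟨w, hw⟩, CoordRing.lift_basis]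
      rw [Finsupp.prod_zero_index, mul_one, ← hu ⟨w, hw⟩]
      refine congrArg Units.val ((Finsupp.prod_single_index (zpow_zero _)).trans (zpow_one _))
    · rw [genSeries_longWord (letterExponent s n) ⟨w, hw⟩, CoordRing.lift_basis]
      simp

theorem isUniversal_GPlus : IsUniversal (GPlus k s n) (GPlusRing k s n) (GPlusElt k s n) := by
  intro R _ _
  constructor
  · intro φ ψ h
    exact CoordRing.hom_ext (closure_trivialExponent s n) (congrFun (congrArg Subtype.val h))
  · rintro ⟨f, hf⟩
    refine ⟨CoordRing.lift 1 fun w => f w.1, Subtype.ext (funext fun w => ?_)⟩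
    change CoordRing.lift _ _ (genSeries k (trivialExponent s n) w) = f w
    by_cases hw : w.length = 1
    · rw [genSeries_trivialExponent k s n w hw, map_one, hf w hw]
    · rw [genSeries_longWord (trivialExponent s n) ⟨w, hw⟩, CoordRing.lift_basis]
      simp

theorem comul_genSeries_G : (isUniversal_G k s n).comul ∘ genSeries k (letterExponent s n) =
    boxConv ((Algebra.TensorProduct.includeLeft : GRing k s n →ₐ[k] GRing k s n ⊗[k] GRing k s n) ∘
        genSeries k (letterExponent s n))
      ((Algebra.TensorProduct.includeRight : GRing k s n →ₐ[k] GRing k s n ⊗[k] GRing k s n) ∘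
        genSeries k (letterExponent s n)) :=
  congrArg Subtype.val (isUniversal_G k s n).map_comul

theorem comul_genSeries_GPlus :
    (isUniversal_GPlus k s n).comul ∘ genSeries k (trivialExponent s n) =
    boxConv ((Algebra.TensorProduct.includeLeft :
        GPlusRing k s n →ₐ[k] GPlusRing k s n ⊗[k] GPlusRing k s n) ∘
        genSeries k (trivialExponent s n))
      ((Algebra.TensorProduct.includeRight :
        GPlusRing k s n →ₐ[k] GPlusRing k s n ⊗[k] GPlusRing k s n) ∘
        genSeries k (trivialExponent s n)) :=
  congrArg Subtype.val (isUniversal_GPlus k s n).map_comul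

theorem isTrigonalisable_G : IsTrigonalisable.{u, v} (G k s n) := by
  refine ⟨GRing k s n, inferInstance, (isUniversal_G k s n).hopfAlgebra (isGroupValued_G k s n),
    GElt k s n, (isUniversal_G k s n).represents _, fun V _ _ _ ρ => ?_⟩
  obtain ⟨x, hx, i, -, h⟩ := (isUniversal_G k s n).exists_coact_eq_tmul (isGroupValued_G k s n)
    (CoordRing.basis k s n _) weight
    (comul_basis_mem_span (closure_letterExponent s n) _ (comul_genSeries_G k s n))
    (comul_basis_of_weight_eq_zero (closure_letterExponent s n) _ (comul_genSeries_G k s n)) ρ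
  exact ⟨x, hx, _, h⟩

theorem isUnipotent_GPlus : IsUnipotent.{u, v} (GPlus k s n) := by
  refine ⟨GPlusRing k s n, inferInstance,
    (isUniversal_GPlus k s n).hopfAlgebra (isGroupValued_GPlus k s n),
    GPlusElt k s n, (isUniversal_GPlus k s n).represents _, fun V _ _ _ ρ => ?_⟩
  obtain ⟨x, hx, i, hi, h⟩ := (isUniversal_GPlus k s n).exists_coact_eq_tmul
    (isGroupValued_GPlus k s n) (CoordRing.basis k s n _) weight
    (comul_basis_mem_span (closure_trivialExponent s n) _ (comul_genSeries_GPlus k s n))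
    (comul_basis_of_weight_eq_zero (closure_trivialExponent s n) _ (comul_genSeries_GPlus k s n)) ρ
  -- Here `N` is trivial, so the weight-zero monomial provided by the lemma is `1` and the
  -- eigenvector is fixed.
  obtain rfl : i = 0 := Prod.ext rfl (eq_zero_of_weight_eq_zero hi)
  exact ⟨x, hx, h⟩

theorem isAffineGroupScheme_GPlus : IsAffineGroupScheme (GPlus k s n) :=
  ⟨GPlusRing k s n, inferInstance,
    (isUniversal_GPlus k s n).hopfAlgebra (isGroupValued_GPlus k s n),
    GPlusElt k s n, (isUniversal_GPlus k s n).represents _⟩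

instance (m : ℕ) : Finite (Word s m) := by
  have : Finite {l : List (Fin s) // l.length ≤ m} :=
    (List.finite_length_le (Fin s) m).to_subtype
  refine Finite.of_injective (β := {l : List (Fin s) // l.length ≤ m})
    (fun w => ⟨w.1, by exact_mod_cast w.2.2⟩) fun w w' h => ?_
  exact Subtype.ext (Subtype.mk.inj h)

instance (N : Type) [AddCommGroup N] [AddGroup.FG N] (m : ℕ) : AddMonoid.FG (Exponent s m N) := by
  have h1 : AddMonoid.FG N := AddGroup.fg_iff_addMonoid_fg.1 inferInstance
  have h2 : AddMonoid.FG (LongWord s m →₀ ℕ) := Module.Finite.iff_addMonoid_fg.1 inferInstance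
  infer_instance

theorem isAlgebraicGroup_G (m : ℕ) : IsAlgebraicGroup (G k s m) := by
  have : AddGroup.FG (Letter s m →₀ ℤ) := Module.Finite.iff_addGroup_fg.1 inferInstance
  exact ⟨GRing k s m, inferInstance, (isUniversal_G k s m).hopfAlgebra (isGroupValued_G k s m),
    GElt k s m, (isUniversal_G k s m).represents _, CoordRing.finiteType k s m _⟩

theorem isAlgebraicGroup_GPlus (m : ℕ) : IsAlgebraicGroup (GPlus k s m) := by
  have : AddGroup.FG PUnit.{1} := Module.Finite.iff_addGroup_fg.1 inferInstance
  exact ⟨GPlusRing k s m, inferInstance,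
    (isUniversal_GPlus k s m).hopfAlgebra (isGroupValued_GPlus k s m),
    GPlusElt k s m, (isUniversal_GPlus k s m).represents _, CoordRing.finiteType k s m _⟩

end Representability

/-! ### Series as inverse limits of their truncations -/

section InverseLimit

variable (k : Type u) [Field k] (s : ℕ)

/-- A word as a word of bounded length. -/
def Word.bounded {s : ℕ} (w : Word s ⊤) (j : ℕ+) (h : w.length ≤ j) : Word s ((j : ℕ) : ℕ∞) :=
  ⟨w.1, w.2.1, by exact_mod_cast h⟩

/-- The length of a word as a positive integer. -/
def Word.posLength {s : ℕ} {n : ℕ∞} (w : Word s n) : ℕ+ :=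
  ⟨w.length, List.length_pos_of_ne_nil w.2.1⟩

/-- The series assembled from a family of truncated series. -/
def glue {s : ℕ} {R : Type*} (f : ∀ j : ℕ+, Word s ((j : ℕ) : ℕ∞) → R) (w : Word s ⊤) : R :=
  f w.posLength (w.bounded w.posLength le_rfl)

theorem glue_comp_incl {s : ℕ} {R : Type*} (f : ∀ j : ℕ+, Word s ((j : ℕ) : ℕ∞) → R)
    (hf : ∀ (i j : ℕ+) (h : ((i : ℕ) : ℕ∞) ≤ ((j : ℕ) : ℕ∞)), f j ∘ Word.incl h = f i) (j : ℕ+) :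
    glue f ∘ Word.incl le_top = f j := by
  funext w
  have h : (((w.posLength : ℕ+) : ℕ) : ℕ∞) ≤ ((j : ℕ) : ℕ∞) := w.2.2
  exact (congrFun (hf w.posLength j h) _).symm

theorem eq_of_comp_incl {s : ℕ} {R : Type*} {f g : Word s ⊤ → R}
    (h : ∀ j : ℕ+, f ∘ Word.incl (m := ((j : ℕ) : ℕ∞)) le_top =
      g ∘ Word.incl (m := ((j : ℕ) : ℕ∞)) le_top) : f = g :=
  funext fun w => congrFun (h w.posLength) (w.bounded w.posLength le_rfl)

/-- A series is determined by its truncations, and truncation respects the convolution, so the glued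
series can be compared degree by degree. -/
theorem glue_boxConv {s : ℕ} {R : Type*} [CommRing R]
    (f g h : ∀ j : ℕ+, Word s ((j : ℕ) : ℕ∞) → R)
    (hf : ∀ (i j : ℕ+) (h : ((i : ℕ) : ℕ∞) ≤ ((j : ℕ) : ℕ∞)), f j ∘ Word.incl h = f i)
    (hg : ∀ (i j : ℕ+) (h : ((i : ℕ) : ℕ∞) ≤ ((j : ℕ) : ℕ∞)), g j ∘ Word.incl h = g i)
    (hh : ∀ j, h j = boxConv (f j) (g j)) : glue h = boxConv (glue f) (glue g) := by
  have hh' : ∀ (i j : ℕ+) (H : ((i : ℕ) : ℕ∞) ≤ ((j : ℕ) : ℕ∞)), h j ∘ Word.incl H = h i := by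
    intro i j H
    rw [hh, hh, boxConv_comp_incl, hf, hg]
  refine eq_of_comp_incl fun j => ?_
  rw [glue_comp_incl h hh', boxConv_comp_incl, glue_comp_incl f hf, glue_comp_incl g hg, hh]

/-- The truncated series given by an element of the vertex of a cone over `((𝔊ˢ₊)ₙ)ₙ`. -/
def GPlus.coneVal {k : Type u} [Field k] {s : ℕ} (c : Cone (GPlus.system k s))
    {R : CommAlgCat.{u} k}
    (x : c.pt.obj R) (j : ℕ+) : Word s ((j : ℕ) : ℕ∞) → R :=
  (((c.π.app (.op j)).app R).hom x : GPlusSet s ((j : ℕ) : ℕ∞) R).1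

theorem GPlus.coneVal_comp_incl {k : Type u} [Field k] {s : ℕ} (c : Cone (GPlus.system k s))
    {R : CommAlgCat.{u} k} (x : c.pt.obj R) (i j : ℕ+) (h : ((i : ℕ) : ℕ∞) ≤ ((j : ℕ) : ℕ∞)) :
    GPlus.coneVal c x j ∘ Word.incl h = GPlus.coneVal c x i := by
  have hij : i ≤ j := by exact_mod_cast h
  have := c.w (homOfLE hij).op
  exact congrArg Subtype.val (DFunLike.congr_fun (congrArg (fun η => (η.app R).hom) this) x)

theorem GPlus.coneVal_map {k : Type u} [Field k] {s : ℕ} (c : Cone (GPlus.system k s))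
    {R R' : CommAlgCat.{u} k} (φ : R ⟶ R') (x : c.pt.obj R) (j : ℕ+) :
    GPlus.coneVal c ((c.pt.map φ).hom x) j = φ.hom ∘ GPlus.coneVal c x j :=
  congrArg Subtype.val (DFunLike.congr_fun
    (congrArg MagmaCat.Hom.hom ((c.π.app (.op j)).naturality φ)) x)

/-- `𝔊ˢ₊` is the inverse limit of the `(𝔊ˢ₊)ₙ`. -/
def GPlus.isLimit : IsLimit (GPlus.cone k s) where
  lift c :=
    { app := fun R => MagmaCat.ofHom
        { toFun := fun x => (⟨glue (GPlus.coneVal c x), fun w hw =>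
              (((c.π.app (.op w.posLength)).app R).hom x : GPlusSet s _ R).2
                (w.bounded w.posLength le_rfl) hw⟩ : GPlusSet s ⊤ R)
          map_mul' := fun x y => Subtype.ext (glue_boxConv _ _ _ (GPlus.coneVal_comp_incl c x)
            (GPlus.coneVal_comp_incl c y) fun j =>
              congrArg Subtype.val (map_mul ((c.π.app (.op j)).app R).hom x y)) }
      naturality := fun R R' φ => by
        refine MagmaCat.hom_ext (DFunLike.ext _ _ fun x => Subtype.ext (funext fun w => ?_))
        exact congrFun (GPlus.coneVal_map c φ x w.posLength) (w.bounded w.posLength le_rfl) }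
  fac c j := NatTrans.ext (funext fun R => MagmaCat.hom_ext (DFunLike.ext _ _ fun x =>
    Subtype.ext (glue_comp_incl _ (GPlus.coneVal_comp_incl c x) j.unop)))
  uniq c m hm := NatTrans.ext (funext fun R => MagmaCat.hom_ext (DFunLike.ext _ _ fun x =>
    Subtype.ext (eq_of_comp_incl fun j => by
      refine Eq.trans ?_ (glue_comp_incl _ (GPlus.coneVal_comp_incl c x) j).symm
      exact congrArg Subtype.val
        (DFunLike.congr_fun (congrArg (fun η => (η.app R).hom) (hm (.op j))) x))))

/-- The truncated series given by an element of the vertex of a cone over `((𝔊ˢ)ₙ)ₙ`. -/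
def G.coneVal {k : Type u} [Field k] {s : ℕ} (c : Cone (G.system k s)) {R : CommAlgCat.{u} k}
    (x : c.pt.obj R) (j : ℕ+) : Word s ((j : ℕ) : ℕ∞) → R :=
  (((c.π.app (.op j)).app R).hom x : GSet s ((j : ℕ) : ℕ∞) R).1

theorem G.coneVal_comp_incl {k : Type u} [Field k] {s : ℕ} (c : Cone (G.system k s))
    {R : CommAlgCat.{u} k} (x : c.pt.obj R) (i j : ℕ+) (h : ((i : ℕ) : ℕ∞) ≤ ((j : ℕ) : ℕ∞)) :
    G.coneVal c x j ∘ Word.incl h = G.coneVal c x i := by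
  have hij : i ≤ j := by exact_mod_cast h
  have := c.w (homOfLE hij).op
  exact congrArg Subtype.val (DFunLike.congr_fun (congrArg (fun η => (η.app R).hom) this) x)

theorem G.coneVal_map {k : Type u} [Field k] {s : ℕ} (c : Cone (G.system k s))
    {R R' : CommAlgCat.{u} k} (φ : R ⟶ R') (x : c.pt.obj R) (j : ℕ+) :
    G.coneVal c ((c.pt.map φ).hom x) j = φ.hom ∘ G.coneVal c x j :=
  congrArg Subtype.val (DFunLike.congr_fun
    (congrArg MagmaCat.Hom.hom ((c.π.app (.op j)).naturality φ)) x)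

/-- `𝔊ˢ` is the inverse limit of the `(𝔊ˢ)ₙ`. -/
def G.isLimit : IsLimit (G.cone k s) where
  lift c :=
    { app := fun R => MagmaCat.ofHom
        { toFun := fun x => (⟨glue (G.coneVal c x), fun w hw =>
              (((c.π.app (.op w.posLength)).app R).hom x : GSet s _ R).2
                (w.bounded w.posLength le_rfl) hw⟩ : GSet s ⊤ R)
          map_mul' := fun x y => Subtype.ext (glue_boxConv _ _ _ (G.coneVal_comp_incl c x)
            (G.coneVal_comp_incl c y) fun j =>
              congrArg Subtype.val (map_mul ((c.π.app (.op j)).app R).hom x y)) }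
      naturality := fun R R' φ => by
        refine MagmaCat.hom_ext (DFunLike.ext _ _ fun x => Subtype.ext (funext fun w => ?_))
        exact congrFun (G.coneVal_map c φ x w.posLength) (w.bounded w.posLength le_rfl) }
  fac c j := NatTrans.ext (funext fun R => MagmaCat.hom_ext (DFunLike.ext _ _ fun x =>
    Subtype.ext (glue_comp_incl _ (G.coneVal_comp_incl c x) j.unop)))
  uniq c m hm := NatTrans.ext (funext fun R => MagmaCat.hom_ext (DFunLike.ext _ _ fun x =>
    Subtype.ext (eq_of_comp_incl fun j => by
      refine Eq.trans ?_ (glue_comp_incl _ (G.coneVal_comp_incl c x) j).symm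
      exact congrArg Subtype.val
        (DFunLike.congr_fun (congrArg (fun η => (η.app R).hom) (hm (.op j))) x))))

end InverseLimit

end FreeBox

theorem mainTheorem10 (k : Type u) [Field k] (s : ℕ) :
    (∀ n : ℕ, 1 ≤ n →
      FreeBox.IsAlgebraicGroup (FreeBox.GPlus k s n) ∧
      FreeBox.IsUnipotent.{u, v} (FreeBox.GPlus k s n)) ∧
    (Nonempty (CategoryTheory.Limits.IsLimit (FreeBox.GPlus.cone k s)) ∧
      FreeBox.IsProUnipotent.{u, v} (FreeBox.GPlus k s ⊤) ∧
      FreeBox.IsUnipotent.{u, v} (FreeBox.GPlus k s ⊤)) ∧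
    (∀ n : ℕ, 1 ≤ n →
      FreeBox.IsAlgebraicGroup (FreeBox.G k s n) ∧
      FreeBox.IsTrigonalisable.{u, v} (FreeBox.G k s n)) ∧
    (Nonempty (CategoryTheory.Limits.IsLimit (FreeBox.G.cone k s)) ∧
      FreeBox.IsTrigonalisable.{u, v} (FreeBox.G k s ⊤)) := by
  refine ⟨fun n _ => ⟨FreeBox.isAlgebraicGroup_GPlus k s n, FreeBox.isUnipotent_GPlus k s n⟩,
    ⟨⟨FreeBox.GPlus.isLimit k s⟩, ⟨FreeBox.isAffineGroupScheme_GPlus k s ⊤, ?_⟩,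
      FreeBox.isUnipotent_GPlus k s ⊤⟩,
    fun n _ => ⟨FreeBox.isAlgebraicGroup_G k s n, FreeBox.isTrigonalisable_G k s n⟩,
    ⟨FreeBox.G.isLimit k s⟩, FreeBox.isTrigonalisable_G k s ⊤⟩
  -- The directed system required for pro-unipotence is the system of truncations itself.
  exact ⟨ℕ+, inferInstance, inferInstance, inferInstance, FreeBox.GPlus.system k s,
    FreeBox.GPlus.cone k s, fun j => ⟨FreeBox.isAlgebraicGroup_GPlus k s _,
      FreeBox.isUnipotent_GPlus k s _⟩, ⟨FreeBox.GPlus.isLimit k s⟩, ⟨Iso.refl _⟩⟩
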